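/- Let $1\le r<s$ be integers. In the semi-random $s$-uniform hypergraph process on $[n]=\{1,\dots,n\}$, one starts with the empty hypergraph $H_0$; in round $t\ge 1$ an $r$-element set $U_t\subseteq[n]$ is chosen uniformly at random, independently of the past, the player replies (possibly at random, depending on $U_t$ and the history) with an $(s-r)$-element set $V_t\subseteq[n]$, and the edge $U_t\cup V_t$ (viewed as a multiset) is added to $H_{t-1}$ to form $H_t$; parallel edges are allowed. For a fixed $s$-uniform hypergraph $G$, let $\mathcal P_G$ be the property of containing a copy of $G$. For a strategy $\mathcal S$ and $0<q<1$ let $\tau(\mathcal S,q,n)$ be the least $t\ge0$ with $\mathbb P[H_t\in\mathcal P_G]\ge q$ ($\infty$ if there is none), let $\tau(q,n)=\inf_{\mathcal S}\tau(\mathcal S,q,n)$ over all strategies on $[n]$, and put $$\tau^{(r)}_{\mathcal P_G}=\lim_{q\to1^-}\limsup_{n\to\infty}\frac{\ln\tau(q,n)}{\ln n}\in[-\infty,\infty].$$ For $2\ell\le s$ and $m\ge3$, the $\ell$-loose $s$-uniform cycle $C_m^{(s,\ell)}$ has $k=(s-\ell)m$ cyclically ordered vertices, and its $m$ edges are the segments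 of $s$ consecutive vertices starting at every $(s-\ell)$-th vertex, so that consecutive edges overlap in exactly $\ell$ vertices. **Proposition.** Let $\ell\ge2$, $m\ge3$, $2\ell\le s$, $1\le r\le s-\ell$, and let $G=C_m^{(s,\ell)}$. Then: 1. if $r\le s-2\ell$, then $\tau^{(r)}_{\mathcal P_G}=0$; 2. if $r\ge s-2\ell+1$, then $\tau^{(r)}_{\mathcal P_G}\ge\frac{r-s+2\ell}{3}$; 3. if $r=s-2\ell+2$, then $\tau^{(r)}_{\mathcal P_G}=\frac23$, and for $m\ge4$ this is strictly larger than $r-\frac{k-s+r}{m}$, the general lower bound for an $s$-uniform hypergraph with $k$ vertices and $m$ edges; 4. if $r\ge s-2\ell+1$, then $\frac{r-s+2\ell}{3}\ge r-\frac{k-s+r}{m}$, with strict inequality for $m\ge4$. -/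

import Mathlib

open Filter Topology
open scoped ENNReal

noncomputable section

namespace SemiRandom

/-- A multi-hypergraph on `[n]`: a finite multiset of edges. An edge is itself a multiset of
vertices, since the random set and the player's set may overlap. -/
abbrev MultiHypergraph (n : ℕ) := Multiset (Multiset (Fin n))

/-- A history of the process: the pairs `(U, V)` played so far, the latest round first, where `U` is
the random set and `V` is the player's reply. -/
abbrev History (n : ℕ) := List (Finset (Fin n) × Finset (Fin n))

/-- The uniform distribution on the `r`-element subsets of `[n]`
(with a dummy value when there are no such subsets, that is, when `n < r`). -/
def uniformSubset (n r : ℕ) : PMF (Finset (Fin n)) :=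
  if h : (Finset.powersetCard r (Finset.univ : Finset (Fin n))).Nonempty then
    PMF.uniformOfFinset _ h
  else PMF.pure ∅

/-- A (randomized) strategy on `[n]`: given the history and the current random set, it provides a
distribution over the `(s - r)`-element subsets of `[n]`. -/
structure Strategy (n r s : ℕ) where
  reply : History n → Finset (Fin n) → PMF (Finset (Fin n))
  card_of_mem_support : ∀ h U, ∀ V ∈ (reply h U).support, V.card = s - r

/-- The law of the history after `t` rounds under the strategy `S`. -/
def historyLaw {n r s : ℕ} (S : Strategy n r s) : ℕ → PMF (History n)
  | 0 => PMF.pure []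
  | t + 1 => (historyLaw S t).bind fun h =>
      (uniformSubset n r).bind fun U => (S.reply h U).map fun V => (U, V) :: h

/-- The multi-hypergraph built along a history: its edges are the sums of `U` and `V` as
multisets. -/
def History.hypergraph {n : ℕ} (h : History n) : MultiHypergraph n :=
  Multiset.ofList (h.map fun p => p.1.val + p.2.val)

/-- The law of the random hypergraph `H_t^{(r,s)}` under the strategy `S`. -/
def hypergraphLaw {n r s : ℕ} (S : Strategy n r s) (t : ℕ) : PMF (MultiHypergraph n) :=
  (historyLaw S t).map History.hypergraph

/-- The probability that `H_t^{(r,s)}` has the property `P`. -/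
def successProb {n r s : ℕ} (S : Strategy n r s) (P : MultiHypergraph n → Prop) (t : ℕ) : ℝ≥0∞ :=
  (hypergraphLaw S t).toOuterMeasure {H | P H}

/-- `τ_P^{(r)}(S, q, n)`: the least `t` with success probability at least `q`,
and `∞` if there is none. -/
def timeOf {n r s : ℕ} (S : Strategy n r s) (P : MultiHypergraph n → Prop) (q : ℝ) : ℕ∞ :=
  ⨅ (t : ℕ) (_ : ENNReal.ofReal q ≤ successProb S P t), (t : ℕ∞)

/-- `τ_P^{(r)}(q, n)`: the infimum over all strategies on `[n]`. -/
def optTime (n r s : ℕ) (P : MultiHypergraph n → Prop) (q : ℝ) : ℕ∞ :=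
  ⨅ S : Strategy n r s, timeOf S P q

/-- `limsup_{n → ∞} ln τ_P^{(r)}(q, n) / ln n`, an extended real number (`ln ∞ = ∞`). -/
def exponentAt (r s : ℕ) (P : ∀ n, MultiHypergraph n → Prop) (q : ℝ) : EReal :=
  limsup (fun n : ℕ =>
    ENNReal.log ((optTime n r s (P n) q : ℕ∞) : ℝ≥0∞) / ((Real.log n : ℝ) : EReal)) atTop

/-- The threshold exponent `τ_P^{(r)}`: the limit of `exponentAt` as `q → 1⁻`. -/
def tau (r s : ℕ) (P : ∀ n, MultiHypergraph n → Prop) : EReal :=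
  limUnder (𝓝[<] (1 : ℝ)) (exponentAt r s P)

theorem exponentAt_mono (r s : ℕ) (P : ∀ n, MultiHypergraph n → Prop) :
    Monotone (exponentAt r s P) := by
  intro q₁ q₂ hq
  refine limsup_le_limsup (Eventually.of_forall fun n => ?_)
  refine EReal.div_le_div_right_of_nonneg ?_ (ENNReal.log_monotone ?_)
  · exact_mod_cast Real.log_natCast_nonneg n
  · refine ENat.toENNReal_le.2 (iInf_mono fun S => iInf_mono fun t => ?_)
    exact iInf_mono' fun h => ⟨(ENNReal.ofReal_le_ofReal hq).trans h, le_rfl⟩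

/-- The limit in the definition of `tau` exists. -/
theorem tendsto_exponentAt (r s : ℕ) (P : ∀ n, MultiHypergraph n → Prop) :
    Tendsto (exponentAt r s P) (𝓝[<] 1) (𝓝 (tau r s P)) :=
  tendsto_nhds_limUnder ⟨_, (exponentAt_mono r s P).tendsto_nhdsLT 1⟩

/-- The property `P_G` of containing a copy of the hypergraph `G`: there is an injection of the
vertices of `G` that maps every edge of `G` to an edge (without repeated vertices) of `H`. -/
def ContainsCopy {α : Type*} (G : Hypergraph α) (n : ℕ) (H : MultiHypergraph n) : Prop :=
  ∃ φ : α → Fin n, Set.InjOn φ G.vertexSet ∧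
    ∀ e ∈ G.edgeSet, ∃ f ∈ H, f.Nodup ∧ {v | v ∈ f} = φ '' e

/-- The `ℓ`-loose `s`-uniform cycle with `m` edges: the vertices are the residues modulo
`(s - ℓ) m`, and the edges are the segments of `s` consecutive vertices that start at the
multiples of `s - ℓ`. -/
def looseCycle (s ℓ m : ℕ) : Hypergraph (ZMod ((s - ℓ) * m)) where
  vertexSet := Set.univ
  edgeSet := {e | ∃ j < m, e = {v | ∃ i < s, v = ((j * (s - ℓ) + i : ℕ) : ZMod ((s - ℓ) * m))}}
  subset_vertexSet_of_mem_edgeSet' := fun _ _ => Set.subset_univ _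

/-- The general lower bound `r - (k - s + r) / m` for the threshold exponent of an `s`-uniform
hypergraph with `k` vertices and `m` edges. -/
def generalLowerBound {α : Type*} (r s : ℕ) (G : Hypergraph α) : ℝ :=
  (r : ℝ) - ((G.vertexSet.ncard : ℝ) - s + r) / (G.edgeSet.ncard : ℝ)

end SemiRandom

end

/-! Write `d = s - ℓ`. Edge `j` of the cycle consists of two links of `ℓ` vertices, shared with the
edges `j - 1` and `j + 1`, and of `d - ℓ = s - 2ℓ` inner vertices on no other edge.

Lower bound. Consider the round that completes a copy. At most `s - 2ℓ` vertices of its random set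
are inner, so at least `x = r - s + 2ℓ` of them lie in the two links, hence in the union of two
edges built earlier (`hasHit_of_isEdge`). After `t` rounds there are at most `t ^ 2` pairs of edges,
and a random `r`-set has `x` vertices in a given union with probability `O(n ^ (-x))`. Summing over
the rounds, a copy appears within `t` rounds with probability `O(t ^ 3 / n ^ x)`, whatever the
strategy (`expect_hasHit_le`), so `t` must be of order `n ^ (x / 3)`.

Upper bounds. `ReachesWithin` replaces an expected hitting time: a phase that succeeds with
probability `p` in each round costs `1 / p` (`ReachesWithin.step`), and a Markov-type argument turns
the total cost into a bound for every `q < 1`. If `r ≤ s - 2ℓ`, a random set of fresh vertices can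
play inner vertices of the next edge, so each edge costs `O(1)`.

If `r = s - 2ℓ + 2`, the edges `2, ..., m - 2` (the core, empty for `m = 3`) are built at cost
`O(1)`. Then each of the links `2` and `-1` receives `N` disjoint petals, that is, `N` candidates
for the edges `1` and `-1`, at cost `O(N)`. A random set with one vertex in a petal of each family
and fresh vertices elsewhere is completed by the player to the edge `0` (`exists_closing`). This has
probability of order `N ^ 2 / n ^ 2`, and `N ≈ n ^ (2 / 3)` balances `N` against `n ^ 2 / N ^ 2`.
The lower bound with `x = 2` matches. -/

noncomputable section

namespace SemiRandom

open Finset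

/-! ### Counting `r`-sets -/

/-- The number of `r`-sets that contain a fixed `x`-set. -/
theorem card_filter_superset_le {n r : ℕ} (hn : 2 * r ≤ n) (hr : 1 ≤ r) (X : Finset (Fin n)) :
    (#{U ∈ powersetCard r (univ : Finset (Fin n)) | X ⊆ U} : ℝ) ≤
      n.choose r * (2 * r / n : ℝ) ^ #X := by
  have hnpos : (0 : ℝ) < n := by exact_mod_cast (by omega : 0 < n)
  by_cases hx : #X ≤ r
  · rw [card_filter_powersetCard_subset X univ r (subset_univ _) hx]
    simp only [card_univ, Fintype.card_fin]
    set x := #X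
    -- The proportion sought is `r.choose x / n.choose x`. The numerator is at most `r ^ x / x!`,
    -- and the denominator at least `(n / 2) ^ x / x!` because `x ≤ r ≤ n / 2`.
    have h1 : n.choose r * r.choose x = n.choose x * (n - x).choose (r - x) := Nat.choose_mul hx
    have h2 : ((n + 1 - x : ℕ) ^ x : ℝ) / x.factorial ≤ n.choose x := Nat.pow_le_choose x n
    have h3 : (r.choose x : ℝ) ≤ (r ^ x : ℝ) / x.factorial := Nat.choose_le_pow_div x r
    have h4 : (n / 2 : ℝ) ^ x ≤ ((n + 1 - x : ℕ) : ℝ) ^ x := by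
      refine pow_le_pow_left₀ (by positivity) ?_ _
      have : (n : ℝ) ≤ 2 * ((n + 1 - x : ℕ) : ℝ) := by exact_mod_cast (by omega)
      linarith
    have hf : (0 : ℝ) < x.factorial := by exact_mod_cast x.factorial_pos
    have h5 : (n / 2 : ℝ) ^ x / x.factorial ≤ n.choose x :=
      (div_le_div_of_nonneg_right h4 hf.le).trans h2
    have h1' : (n.choose r * r.choose x : ℝ) = n.choose x * (n - x).choose (r - x) := by
      exact_mod_cast h1
    have h6 : (n / 2 : ℝ) ^ x / x.factorial * (n - x).choose (r - x) ≤
        n.choose r * ((r ^ x : ℝ) / x.factorial) := by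
      calc _ ≤ (n.choose x : ℝ) * (n - x).choose (r - x) := by gcongr
        _ = n.choose r * r.choose x := h1'.symm
        _ ≤ _ := by gcongr
    have h7 : (2 * r / n : ℝ) ^ x = ((r : ℝ) ^ x / x.factorial) / ((n / 2 : ℝ) ^ x / x.factorial) := by
      rw [div_div_div_cancel_right₀ hf.ne', ← div_pow]
      congr 1
      field_simp
    rw [h7, ← mul_div_assoc, le_div_iff₀ (by positivity)]
    linarith
  · rw [filter_false_of_mem]
    · simp only [card_empty, Nat.cast_zero]; positivity
    · intro U hU hXU
      exact hx ((card_le_card hXU).trans_eq (mem_powersetCard.1 hU).2)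

/-- The number of `r`-sets that meet a fixed set in at least `x` elements. -/
theorem card_filter_inter_le {n r : ℕ} (hn : 2 * r ≤ n) (hr : 1 ≤ r) (x : ℕ)
    (W : Finset (Fin n)) :
    (#{U ∈ powersetCard r (univ : Finset (Fin n)) | x ≤ #(U ∩ W)} : ℝ) ≤
      n.choose r * ((#W).choose x * (2 * r / n : ℝ) ^ x) := by
  have hsub : {U ∈ powersetCard r (univ : Finset (Fin n)) | x ≤ #(U ∩ W)} ⊆
      (powersetCard x W).biUnion
        fun X => {U ∈ powersetCard r (univ : Finset (Fin n)) | X ⊆ U} := by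
    intro U hU
    rw [mem_filter] at hU
    obtain ⟨X, hX, hXc⟩ := exists_subset_card_eq hU.2
    simp only [mem_biUnion, mem_filter]
    exact ⟨X, mem_powersetCard.2 ⟨hX.trans inter_subset_right, hXc⟩, hU.1,
      hX.trans inter_subset_left⟩
  calc _ ≤ ((∑ X ∈ powersetCard x W,
        #{U ∈ powersetCard r (univ : Finset (Fin n)) | X ⊆ U} : ℕ) : ℝ) := by
        exact_mod_cast (card_le_card hsub).trans card_biUnion_le
    _ = ∑ X ∈ powersetCard x W,
        (#{U ∈ powersetCard r (univ : Finset (Fin n)) | X ⊆ U} : ℝ) := by push_cast; rfl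
    _ ≤ ∑ X ∈ powersetCard x W, n.choose r * (2 * r / n : ℝ) ^ x := by
        refine sum_le_sum fun X hX => ?_
        have := card_filter_superset_le hn hr X
        rwa [(mem_powersetCard.1 hX).2] at this
    _ = _ := by rw [sum_const, card_powersetCard, nsmul_eq_mul]; ring

/-- At least half of the `r`-sets avoid a given small set. -/
theorem choose_le_two_mul_card_filter_disjoint {n r : ℕ} (hr : 1 ≤ r) (D : Finset (Fin n))
    (hn : 4 * r * (#D + 1) ≤ n) :
    (n.choose r : ℝ) ≤ 2 * #{U ∈ powersetCard r (univ : Finset (Fin n)) | Disjoint U D} := by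
  have hnpos : (0 : ℝ) < n := by exact_mod_cast (by nlinarith : 0 < n)
  have h1 := card_filter_inter_le (n := n) (r := r) (by nlinarith) hr 1 D
  have h2 := card_filter_add_card_filter_not (s := powersetCard r (univ : Finset (Fin n)))
    (fun U => Disjoint U D)
  have h3 : {U ∈ powersetCard r (univ : Finset (Fin n)) | ¬ Disjoint U D} =
      {U ∈ powersetCard r (univ : Finset (Fin n)) | 1 ≤ #(U ∩ D)} := by
    refine filter_congr fun U _ => ?_
    rw [disjoint_iff_inter_eq_empty, Nat.one_le_iff_ne_zero, Ne, card_eq_zero]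
  rw [h3, card_powersetCard, card_univ, Fintype.card_fin] at h2
  have h2' : (#{U ∈ powersetCard r (univ : Finset (Fin n)) | Disjoint U D} : ℝ) +
      #{U ∈ powersetCard r (univ : Finset (Fin n)) | 1 ≤ #(U ∩ D)} = n.choose r := by
    exact_mod_cast h2
  -- A random `r`-set meets `D` with probability at most `#D * 2r / n`; the hypothesis on `n` makes
  -- this at most `1 / 2`.
  have h4 : ((#D).choose 1 * (2 * r / n : ℝ) ^ 1) ≤ 1 / 2 := by
    rw [Nat.choose_one_right, pow_one, mul_div_assoc', div_le_iff₀ hnpos]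
    have : (4 * r * (#D + 1) : ℝ) ≤ n := by exact_mod_cast hn
    nlinarith
  have h5 : (n.choose r : ℝ) * ((#D).choose 1 * (2 * r / n : ℝ) ^ 1) ≤ n.choose r * (1 / 2) := by
    gcongr
  linarith

/-- The number of `r`-sets with one element in `A`, one in `B` and the others outside of `D`. -/
theorem choose_mul_le_card_transversal {n r : ℕ} (hr : 2 ≤ r) {A B D : Finset (Fin n)}
    (hA : A ⊆ D) (hB : B ⊆ D) (hAB : Disjoint A B) (hn : 2 * (#D + r) ≤ n)
    (𝒰 : Finset (Finset (Fin n)))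
    (h𝒰 : ∀ a ∈ A, ∀ b ∈ B, ∀ W, #W = r - 2 → Disjoint W D → insert a (insert b W) ∈ 𝒰) :
    (n.choose r : ℝ) * (#A * #B / (2 ^ r * n ^ 2)) ≤ #𝒰 := by
  have hnpos : (0 : ℝ) < n := by exact_mod_cast (by omega : 0 < n)
  have h1 : #A * #B * (n - #D).choose (r - 2) ≤ #𝒰 := by
    -- The triple can be read off from its set, since `A`, `B` and `Dᶜ` are pairwise disjoint.
    have : #(A ×ˢ B ×ˢ powersetCard (r - 2) Dᶜ) ≤ #𝒰 := by
      refine card_le_card_of_injOn (fun q => insert q.1 (insert q.2.1 q.2.2)) ?_ ?_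
      · rintro ⟨a, b, W⟩ h
        simp only [coe_product, Set.mem_prod, mem_coe, mem_powersetCard] at h
        exact h𝒰 a h.1 b h.2.1 W h.2.2.2 (subset_compl_iff_disjoint_right.1 h.2.2.1)
      · rintro ⟨a, b, W⟩ h ⟨a', b', W'⟩ h' he
        simp only [coe_product, Set.mem_prod, mem_coe, mem_powersetCard] at h h'
        obtain ⟨ha, hb, hW, -⟩ := h
        obtain ⟨ha', hb', hW', -⟩ := h'
        simp only at he
        have hW1 : ∀ v ∈ W, v ∉ D := fun v hv => mem_compl.1 (hW hv)
        have hW2 : ∀ v ∈ W', v ∉ D := fun v hv => mem_compl.1 (hW' hv)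
        have hd : ∀ v ∈ A, v ∉ B := fun v hv hv' => disjoint_left.1 hAB hv hv'
        have e : ∀ v, (v = a ∨ v = b ∨ v ∈ W) ↔ (v = a' ∨ v = b' ∨ v ∈ W') := fun v => by
          simpa using (Finset.ext_iff.1 he v)
        have haa : a = a' := by
          rcases (e a).1 (Or.inl rfl) with h | h | h
          · exact h
          · exact absurd (h ▸ hb') (hd a ha)
          · exact absurd (hA ha) (hW2 a h)
        have hbb : b = b' := by
          rcases (e b).1 (Or.inr (Or.inl rfl)) with h | h | h
          · exact absurd hb (hd b (h ▸ ha'))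
          · exact h
          · exact absurd (hB hb) (hW2 b h)
        subst haa hbb
        have hWW : W = W' := by
          ext v
          refine ⟨fun hv => ?_, fun hv => ?_⟩
          · rcases (e v).1 (Or.inr (Or.inr hv)) with h | h | h
            · exact absurd (hA ha) (h ▸ hW1 v hv)
            · exact absurd (hB hb) (h ▸ hW1 v hv)
            · exact h
          · rcases (e v).2 (Or.inr (Or.inr hv)) with h | h | h
            · exact absurd (hA ha) (h ▸ hW2 v hv)
            · exact absurd (hB hb) (h ▸ hW2 v hv)
            · exact h
        rw [hWW]
    simpa [card_product, card_powersetCard, card_compl, mul_assoc] using this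
  have h1' : (#A * #B * (n - #D).choose (r - 2) : ℝ) ≤ #𝒰 := by exact_mod_cast h1
  refine le_trans ?_ h1'
  have h2 : ((n - #D + 1 - (r - 2) : ℕ) ^ (r - 2) : ℝ) / (r - 2).factorial ≤
      (n - #D).choose (r - 2) := Nat.pow_le_choose (r - 2) (n - #D)
  have h3 : (n.choose r : ℝ) ≤ (n ^ r : ℝ) / r.factorial := Nat.choose_le_pow_div r n
  have h4 : (n / 2 : ℝ) ^ (r - 2) ≤ ((n - #D + 1 - (r - 2) : ℕ) : ℝ) ^ (r - 2) := by
    refine pow_le_pow_left₀ (by positivity) ?_ _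
    have : (n : ℝ) ≤ 2 * ((n - #D + 1 - (r - 2) : ℕ) : ℝ) := by exact_mod_cast (by omega)
    linarith
  have h5 : (n ^ r : ℝ) / r.factorial ≤ n ^ r / (r - 2).factorial := by
    have : ((r - 2).factorial : ℝ) ≤ r.factorial := by
      exact_mod_cast Nat.factorial_le (by omega)
    have : (0 : ℝ) < (r - 2).factorial := by exact_mod_cast (r - 2).factorial_pos
    gcongr
  -- `(n / 2) ^ (r - 2)` would give the denominator `2 ^ (r - 2) * n ^ 2`; the power `2 ^ r` gives
  -- away a factor of 4.
  have h6 : (n.choose r : ℝ) / (2 ^ r * n ^ 2) ≤ (n - #D).choose (r - 2) := by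
    have hf : (0 : ℝ) < (r - 2).factorial := by exact_mod_cast (r - 2).factorial_pos
    calc (n.choose r : ℝ) / (2 ^ r * n ^ 2) ≤ (n ^ r / (r - 2).factorial) / (2 ^ r * n ^ 2) := by
          gcongr; exact h3.trans h5
      _ = (n / 2 : ℝ) ^ (r - 2) / (r - 2).factorial / 4 := by
          obtain ⟨k, rfl⟩ := Nat.exists_eq_add_of_le' hr
          rw [Nat.add_sub_cancel, div_pow, pow_add, pow_add]
          field_simp
          norm_num
      _ ≤ (n / 2 : ℝ) ^ (r - 2) / (r - 2).factorial := by
          have : 0 ≤ (n / 2 : ℝ) ^ (r - 2) / (r - 2).factorial := by positivity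
          linarith
      _ ≤ _ := (div_le_div_of_nonneg_right h4 hf.le).trans h2
  calc (n.choose r : ℝ) * (#A * #B / (2 ^ r * n ^ 2))
      = #A * #B * (n.choose r / (2 ^ r * n ^ 2)) := by ring
    _ ≤ _ := by gcongr

/-! ### Expectations -/

/-- The expectation of a nonnegative function. -/
def expect {α : Type*} (p : PMF α) (g : α → ℝ≥0∞) : ℝ≥0∞ := ∑' a, p a * g a

theorem expect_pure {α : Type*} (a : α) (g : α → ℝ≥0∞) : expect (PMF.pure a) g = g a := by
  rw [expect, tsum_eq_single a]
  · simp
  · intro b hb; simp [PMF.pure_apply, hb]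

theorem expect_bind {α β : Type*} (p : PMF α) (f : α → PMF β) (g : β → ℝ≥0∞) :
    expect (p.bind f) g = expect p fun a => expect (f a) g := by
  simp only [expect, PMF.bind_apply, ← ENNReal.tsum_mul_right, ← ENNReal.tsum_mul_left]
  rw [ENNReal.tsum_comm]
  simp only [mul_assoc]

theorem expect_map {α β : Type*} (p : PMF α) (f : α → β) (g : β → ℝ≥0∞) :
    expect (p.map f) g = expect p (g ∘ f) := by
  rw [PMF.map, expect_bind]
  simp only [Function.comp_def, expect_pure]

theorem expect_mono {α : Type*} (p : PMF α) {g g' : α → ℝ≥0∞}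
    (h : ∀ a ∈ p.support, g a ≤ g' a) : expect p g ≤ expect p g' := by
  refine ENNReal.tsum_le_tsum fun a => ?_
  by_cases ha : p a = 0
  · simp [ha]
  · exact mul_le_mul_right (h a ((p.mem_support_iff a).2 ha)) _

theorem expect_const {α : Type*} (p : PMF α) (c : ℝ≥0∞) : expect p (fun _ => c) = c := by
  rw [expect, ENNReal.tsum_mul_right, p.tsum_coe, one_mul]

theorem expect_add {α : Type*} (p : PMF α) (g g' : α → ℝ≥0∞) :
    expect p (fun a => g a + g' a) = expect p g + expect p g' := by
  simp only [expect, mul_add, ENNReal.tsum_add]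

theorem toOuterMeasure_eq_expect {α : Type*} (p : PMF α) (s : Set α) :
    p.toOuterMeasure s = expect p (s.indicator 1) := by
  rw [PMF.toOuterMeasure_apply, expect]
  refine tsum_congr fun a => ?_
  by_cases h : a ∈ s <;> simp [h]

theorem powersetCard_univ_nonempty {n r : ℕ} (h : r ≤ n) :
    (powersetCard r (univ : Finset (Fin n))).Nonempty :=
  powersetCard_nonempty.2 (by simpa using h)

theorem expect_uniformSubset {n r : ℕ} (h : r ≤ n) (g : Finset (Fin n) → ℝ≥0∞) :
    expect (uniformSubset n r) g =
      (∑ U ∈ powersetCard r (univ : Finset (Fin n)), g U) / (n.choose r : ℝ≥0∞) := by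
  have hne := powersetCard_univ_nonempty h
  rw [uniformSubset, dif_pos hne, expect, tsum_eq_sum (s := powersetCard r univ)]
  · rw [ENNReal.div_eq_inv_mul, mul_sum]
    refine sum_congr rfl fun U hU => ?_
    rw [PMF.uniformOfFinset_apply_of_mem hne hU]
    simp
  · intro U hU
    rw [PMF.uniformOfFinset_apply_of_notMem hne hU, zero_mul]

theorem card_of_mem_support_uniformSubset {n r : ℕ} (h : r ≤ n) {U : Finset (Fin n)}
    (hU : U ∈ (uniformSubset n r).support) : #U = r := by
  have hne := powersetCard_univ_nonempty h
  rw [uniformSubset, dif_pos hne, PMF.mem_support_uniformOfFinset_iff] at hU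
  exact (mem_powersetCard.1 hU).2

theorem successProb_eq_expect {n r s : ℕ} (S : Strategy n r s) (P : MultiHypergraph n → Prop)
    (t : ℕ) : successProb S P t =
      expect (historyLaw S t) ({h : History n | P h.hypergraph}.indicator 1) := by
  rw [successProb, hypergraphLaw, PMF.toOuterMeasure_map_apply, toOuterMeasure_eq_expect]
  rfl

theorem expect_historyLaw_succ {n r s : ℕ} (S : Strategy n r s) (t : ℕ) (g : History n → ℝ≥0∞) :
    expect (historyLaw S (t + 1)) g = expect (historyLaw S t) fun h =>
      expect (uniformSubset n r) fun U => expect (S.reply h U) fun V => g ((U, V) :: h) := by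
  rw [historyLaw, expect_bind]
  simp only [expect_bind, expect_map, Function.comp_def]

/-! ### Lower bounds: a random set that meets two earlier edges in many vertices -/

/-- Some random set meets the union of two earlier edges in at least `x` vertices. -/
def HasHit {n : ℕ} (x : ℕ) : History n → Prop
  | [] => False
  | p :: h => HasHit x h ∨ ∃ a ∈ h, ∃ b ∈ h, x ≤ #(p.1 ∩ (a.1 ∪ a.2 ∪ (b.1 ∪ b.2)))

/-- All sets played have the prescribed sizes. -/
def Valid {n : ℕ} (r s : ℕ) (h : History n) : Prop := ∀ p ∈ h, #p.1 = r ∧ #p.2 = s - r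

theorem valid_of_mem_support {n r s : ℕ} (hn : r ≤ n) (S : Strategy n r s) (t : ℕ) :
    ∀ h ∈ (historyLaw S t).support, h.length = t ∧ Valid r s h := by
  induction t with
  | zero =>
    intro h hh
    simp only [historyLaw, PMF.support_pure, Set.mem_singleton_iff] at hh
    subst hh
    exact ⟨rfl, fun p hp => by simp at hp⟩
  | succ t ih =>
    intro h hh
    simp only [historyLaw, PMF.mem_support_bind_iff, PMF.mem_support_map_iff] at hh
    obtain ⟨h', hh', U, hU, V, hV, rfl⟩ := hh
    obtain ⟨hl, hv⟩ := ih h' hh'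
    refine ⟨by simp [hl], fun p hp => ?_⟩
    rcases List.mem_cons.1 hp with rfl | hp
    · exact ⟨card_of_mem_support_uniformSubset hn hU, S.card_of_mem_support _ _ _ hV⟩
    · exact hv p hp

/-- A union bound over the ordered pairs of earlier rounds: there are at most `h.length ^ 2` of
them, and two edges together cover at most `2 * s` vertices. -/
theorem card_filter_hit_le {n r s x : ℕ} (hr : 1 ≤ r) (hrs : r ≤ s) (hn : 2 * r ≤ n)
    {h : History n} (hv : Valid r s h) :
    (#{U ∈ powersetCard r (univ : Finset (Fin n)) |
      ∃ a ∈ h, ∃ b ∈ h, x ≤ #(U ∩ (a.1 ∪ a.2 ∪ (b.1 ∪ b.2)))} : ℝ) ≤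
      n.choose r * (h.length ^ 2 * ((2 * s).choose x * (2 * r / n : ℝ) ^ x)) := by
  have hsub : {U ∈ powersetCard r (univ : Finset (Fin n)) |
      ∃ a ∈ h, ∃ b ∈ h, x ≤ #(U ∩ (a.1 ∪ a.2 ∪ (b.1 ∪ b.2)))} ⊆
      (h.toFinset ×ˢ h.toFinset).biUnion fun q =>
        {U ∈ powersetCard r (univ : Finset (Fin n)) |
          x ≤ #(U ∩ (q.1.1 ∪ q.1.2 ∪ (q.2.1 ∪ q.2.2)))} := by
    intro U hU
    rw [mem_filter] at hU
    obtain ⟨hU, a, ha, b, hb, hx⟩ := hU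
    simp only [mem_biUnion, mem_product, List.mem_toFinset, mem_filter]
    exact ⟨(a, b), ⟨ha, hb⟩, hU, hx⟩
  have hcard : ∀ a ∈ h, #(a.1 ∪ a.2) ≤ s := fun a ha => by
    have := card_union_le a.1 a.2
    have := hv a ha
    omega
  calc _ ≤ ((∑ q ∈ h.toFinset ×ˢ h.toFinset, #{U ∈ powersetCard r (univ : Finset (Fin n)) |
          x ≤ #(U ∩ (q.1.1 ∪ q.1.2 ∪ (q.2.1 ∪ q.2.2)))} : ℕ) : ℝ) := by
        exact_mod_cast (card_le_card hsub).trans card_biUnion_le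
    _ = ∑ q ∈ h.toFinset ×ˢ h.toFinset, (#{U ∈ powersetCard r (univ : Finset (Fin n)) |
          x ≤ #(U ∩ (q.1.1 ∪ q.1.2 ∪ (q.2.1 ∪ q.2.2)))} : ℝ) := by push_cast; rfl
    _ ≤ ∑ q ∈ h.toFinset ×ˢ h.toFinset,
          (n.choose r * ((2 * s).choose x * (2 * r / n : ℝ) ^ x)) := by
        refine sum_le_sum fun q hq => (card_filter_inter_le hn hr x _).trans ?_
        rw [mem_product, List.mem_toFinset, List.mem_toFinset] at hq
        have h1 := card_union_le (q.1.1 ∪ q.1.2) (q.2.1 ∪ q.2.2)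
        have h2 := hcard _ hq.1
        have h3 := hcard _ hq.2
        gcongr
        omega
    _ = (#h.toFinset * #h.toFinset : ℝ) *
          (n.choose r * ((2 * s).choose x * (2 * r / n : ℝ) ^ x)) := by
        rw [sum_const, card_product, nsmul_eq_mul]; push_cast; ring
    _ ≤ (h.length * h.length : ℝ) * (n.choose r * ((2 * s).choose x * (2 * r / n : ℝ) ^ x)) := by
        have : (#h.toFinset : ℝ) ≤ h.length := by exact_mod_cast h.toFinset_card_le
        gcongr
    _ = _ := by ring

theorem expect_uniformSubset_indicator {n r : ℕ} (h : r ≤ n) (p : Finset (Fin n) → Prop)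
    [DecidablePred p] :
    expect (uniformSubset n r) ({U | p U}.indicator 1) =
      ENNReal.ofReal (#{U ∈ powersetCard r (univ : Finset (Fin n)) | p U} / n.choose r) := by
  have hc : (0 : ℝ) < n.choose r := by exact_mod_cast Nat.choose_pos h
  rw [expect_uniformSubset h, ENNReal.ofReal_div_of_pos hc, ENNReal.ofReal_natCast,
    ENNReal.ofReal_natCast, card_filter]
  congr 1
  push_cast
  exact sum_congr rfl fun U _ => by simp [Set.indicator_apply]

/-- The probability of a hit within `t` rounds is `O(t ^ 3 / n ^ x)`. -/
theorem expect_hasHit_le {n r s x : ℕ} (hr : 1 ≤ r) (hrs : r ≤ s) (hn : 2 * r ≤ n)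
    (S : Strategy n r s) (t : ℕ) :
    expect (historyLaw S t) ({h | HasHit x h}.indicator 1) ≤
      ENNReal.ofReal (t ^ 3 * ((2 * s).choose x * (2 * r / n : ℝ) ^ x)) := by
  classical
  set δ : ℝ := (2 * s).choose x * (2 * r / n : ℝ) ^ x with hδ
  have hδ0 : 0 ≤ δ := by positivity
  have hrn : r ≤ n := by omega
  have hc : (0 : ℝ) < n.choose r := by exact_mod_cast Nat.choose_pos hrn
  induction t with
  | zero =>
    rw [historyLaw, expect_pure]
    simp [HasHit]
  | succ t ih =>
    rw [expect_historyLaw_succ]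
    calc _ ≤ expect (historyLaw S t) fun h =>
          ({h | HasHit x h}.indicator 1 : History n → ℝ≥0∞) h + ENNReal.ofReal (t ^ 2 * δ) := by
          refine expect_mono _ fun h hh => ?_
          obtain ⟨hl, hv⟩ := valid_of_mem_support hrn S t h hh
          let B : Finset (Fin n) → Prop := fun U =>
            ∃ a ∈ h, ∃ b ∈ h, x ≤ #(U ∩ (a.1 ∪ a.2 ∪ (b.1 ∪ b.2)))
          -- A new hit depends on `U` and the history only, not on the reply `V`; this makes the
          -- bound uniform in the strategy.
          have key : ∀ U V, ({h | HasHit x h}.indicator 1 : History n → ℝ≥0∞) ((U, V) :: h) ≤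
              ({h | HasHit x h}.indicator 1 : History n → ℝ≥0∞) h +
                ({U | B U}.indicator 1 : Finset (Fin n) → ℝ≥0∞) U := by
            intro U V
            simp only [Set.indicator_apply, Set.mem_ofPred_eq, Pi.one_apply]
            have : HasHit x ((U, V) :: h) ↔ (HasHit x h ∨ B U) := Iff.rfl
            by_cases h1 : HasHit x h
            · rw [if_pos h1]; split_ifs <;> simp
            · by_cases h2 : B U
              · rw [if_pos h2]; split_ifs <;> simp
              · rw [if_neg fun hh => (this.1 hh).elim h1 h2]; simp
          calc _ ≤ expect (uniformSubset n r) fun U =>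
                ({h | HasHit x h}.indicator 1 : History n → ℝ≥0∞) h +
                ({U | B U}.indicator 1 : Finset (Fin n) → ℝ≥0∞) U := by
                refine expect_mono _ fun U _ => ?_
                refine (expect_mono _ fun V _ => key U V).trans ?_
                rw [expect_const]
            _ ≤ _ := by
                rw [expect_add, expect_const]
                gcongr
                refine (expect_uniformSubset_indicator hrn B).trans_le
                  (ENNReal.ofReal_le_ofReal ?_)
                rw [div_le_iff₀ hc]
                have := card_filter_hit_le (x := x) hr hrs hn hv
                rw [hl, ← hδ] at this
                exact this.trans_eq (by ring)
      _ ≤ ENNReal.ofReal (t ^ 3 * δ) + ENNReal.ofReal (t ^ 2 * δ) := by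
          rw [expect_add, expect_const]
          gcongr
      _ ≤ _ := by
          rw [← ENNReal.ofReal_add (by positivity) (by positivity)]
          refine ENNReal.ofReal_le_ofReal ?_
          push_cast
          have : (t : ℝ) ^ 3 + t ^ 2 ≤ (t + 1) ^ 3 := by
            have : (0 : ℝ) ≤ t := by positivity
            nlinarith [sq_nonneg (t : ℝ)]
          nlinarith

/-- If the property forces a hit, then the optimal time is at least of order `n ^ (x / 3)`. -/
theorem le_optTime_of_hasHit {r s x : ℕ} (hr : 1 ≤ r) (hrs : r ≤ s)
    (P : ∀ n, MultiHypergraph n → Prop)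
    (hP : ∀ n (h : History n), Valid r s h → P n h.hypergraph → HasHit x h)
    {q : ℝ} (hq : 0 < q) :
    ∃ c : ℝ, 0 < c ∧ ∀ᶠ n : ℕ in atTop,
      ENNReal.ofReal (c * (n : ℝ) ^ ((x : ℝ) / 3)) ≤ ((optTime n r s (P n) q : ℕ∞) : ℝ≥0∞) := by
  -- The summand 1 keeps `K` positive even if the binomial coefficient vanishes.
  set K : ℝ := (2 * s).choose x * (2 * r : ℝ) ^ x + 1 with hK
  have hK0 : 0 < K := by positivity
  refine ⟨(q / K) ^ ((1 : ℝ) / 3), by positivity, ?_⟩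
  filter_upwards [eventually_ge_atTop (2 * r)] with n hn
  have hn0 : (0 : ℝ) < n := by exact_mod_cast (by omega : 0 < n)
  have key : ∀ (S : Strategy n r s) (t : ℕ), ENNReal.ofReal q ≤ successProb S (P n) t →
      (q / K) ^ ((1 : ℝ) / 3) * (n : ℝ) ^ ((x : ℝ) / 3) ≤ t := by
    intro S t h
    have h1 : successProb S (P n) t ≤
        ENNReal.ofReal (t ^ 3 * ((2 * s).choose x * (2 * r / n : ℝ) ^ x)) := by
      rw [successProb_eq_expect]
      refine (expect_mono _ fun h hh => ?_).trans (expect_hasHit_le (x := x) hr hrs hn S t)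
      have hv := (valid_of_mem_support (by omega) S t h hh).2
      by_cases h1 : P n h.hypergraph
      · rw [Set.indicator_of_mem (show h ∈ {h : History n | HasHit x h} from hP n h hv h1)]
        exact Set.indicator_apply_le fun _ => le_rfl
      · rw [Set.indicator_of_notMem (show h ∉ {h : History n | P n h.hypergraph} from h1)]
        exact zero_le
    have h2 : q ≤ t ^ 3 * ((2 * s).choose x * (2 * r / n : ℝ) ^ x) := by
      have := h.trans h1
      rwa [ENNReal.ofReal_le_ofReal_iff (by positivity)] at this
    have h3 : q / K * (n : ℝ) ^ x ≤ t ^ 3 := by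
      rw [div_pow] at h2
      rw [div_mul_eq_mul_div, div_le_iff₀ hK0]
      have : q * (n : ℝ) ^ x ≤ t ^ 3 * ((2 * s).choose x * (2 * r : ℝ) ^ x) := by
        rw [← mul_div_assoc, ← mul_div_assoc, le_div_iff₀ (by positivity)] at h2
        exact h2
      have ht : (0 : ℝ) ≤ t ^ 3 := by positivity
      rw [hK]
      nlinarith
    calc (q / K) ^ ((1 : ℝ) / 3) * (n : ℝ) ^ ((x : ℝ) / 3)
        = (q / K * (n : ℝ) ^ x) ^ ((1 : ℝ) / 3) := by
          rw [Real.mul_rpow (by positivity) (by positivity), ← Real.rpow_natCast n x,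
            ← Real.rpow_mul hn0.le, mul_one_div]
      _ ≤ ((t : ℝ) ^ 3) ^ ((1 : ℝ) / 3) := by
          exact Real.rpow_le_rpow (by positivity) h3 (by norm_num)
      _ = t := by
          rw [← Real.rpow_natCast, ← Real.rpow_mul (by positivity)]
          norm_num
  set y := (q / K) ^ ((1 : ℝ) / 3) * (n : ℝ) ^ ((x : ℝ) / 3)
  have h4 : ((⌈y⌉₊ : ℕ) : ℕ∞) ≤ optTime n r s (P n) q :=
    le_iInf fun S => le_iInf fun t => le_iInf fun h => by
      exact_mod_cast Nat.ceil_le.2 (key S t h)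
  calc ENNReal.ofReal y ≤ ENNReal.ofReal (⌈y⌉₊ : ℝ) := ENNReal.ofReal_le_ofReal (Nat.le_ceil y)
    _ = (((⌈y⌉₊ : ℕ) : ℕ∞) : ℝ≥0∞) := by simp
    _ ≤ _ := ENat.toENNReal_le.2 h4

/-! ### Exponents -/

theorem log_ofReal_mul_rpow_div {c a : ℝ} (hc : 0 < c) {n : ℕ} (hn : 2 ≤ n) :
    ENNReal.log (ENNReal.ofReal (c * (n : ℝ) ^ a)) / ((Real.log n : ℝ) : EReal) =
      ((Real.log c / Real.log n + a : ℝ) : EReal) := by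
  have hn0 : (0 : ℝ) < n := by exact_mod_cast (by omega : 0 < n)
  have hl : 0 < Real.log n := Real.log_pos (by exact_mod_cast (by omega : 1 < n))
  rw [ENNReal.log_ofReal_of_pos (by positivity), ← EReal.coe_div,
    Real.log_mul hc.ne' (by positivity), Real.log_rpow hn0]
  congr 1
  field_simp

/-- Constant factors do not affect exponents, which is why time bounds are only needed up to a
constant depending on `q`. -/
theorem tendsto_log_const_div (c a : ℝ) :
    Tendsto (fun n : ℕ => ((Real.log c / Real.log n + a : ℝ) : EReal)) atTop (𝓝 (a : EReal)) := by
  have h : Tendsto (fun n : ℕ => Real.log c / Real.log n) atTop (𝓝 0) :=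
    (Real.tendsto_log_atTop.comp tendsto_natCast_atTop_atTop).const_div_atTop _
  have h2 := h.add_const a
  rw [zero_add] at h2
  exact (continuous_coe_real_ereal.tendsto a).comp h2

theorem le_exponentAt {r s : ℕ} {P : ∀ n, MultiHypergraph n → Prop} {q c a : ℝ} (hc : 0 < c)
    (h : ∀ᶠ n : ℕ in atTop,
      ENNReal.ofReal (c * (n : ℝ) ^ a) ≤ ((optTime n r s (P n) q : ℕ∞) : ℝ≥0∞)) :
    (a : EReal) ≤ exponentAt r s P q := by
  rw [← (tendsto_log_const_div c a).limsup_eq]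
  refine limsup_le_limsup ?_
  filter_upwards [h, eventually_ge_atTop 2] with n hn h2
  rw [← log_ofReal_mul_rpow_div hc h2]
  refine EReal.div_le_div_right_of_nonneg ?_ (ENNReal.log_monotone hn)
  exact_mod_cast Real.log_natCast_nonneg n

theorem exponentAt_le {r s : ℕ} {P : ∀ n, MultiHypergraph n → Prop} {q c a : ℝ} (hc : 0 < c)
    (h : ∀ᶠ n : ℕ in atTop,
      ((optTime n r s (P n) q : ℕ∞) : ℝ≥0∞) ≤ ENNReal.ofReal (c * (n : ℝ) ^ a)) :
    exponentAt r s P q ≤ (a : EReal) := by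
  rw [← (tendsto_log_const_div c a).limsup_eq]
  refine limsup_le_limsup ?_
  filter_upwards [h, eventually_ge_atTop 2] with n hn h2
  rw [← log_ofReal_mul_rpow_div hc h2]
  refine EReal.div_le_div_right_of_nonneg ?_ (ENNReal.log_monotone hn)
  exact_mod_cast Real.log_natCast_nonneg n

theorem eventually_mem_Ioo_nhdsLT_one : ∀ᶠ q : ℝ in 𝓝[<] 1, q ∈ Set.Ioo (0 : ℝ) 1 :=
  Ioo_mem_nhdsLT zero_lt_one

theorem le_tau {r s : ℕ} {P : ∀ n, MultiHypergraph n → Prop} {a : EReal}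
    (h : ∀ q : ℝ, 0 < q → q < 1 → a ≤ exponentAt r s P q) : a ≤ tau r s P :=
  ge_of_tendsto (tendsto_exponentAt r s P)
    (eventually_mem_Ioo_nhdsLT_one.mono fun q hq => h q hq.1 hq.2)

theorem tau_le {r s : ℕ} {P : ∀ n, MultiHypergraph n → Prop} {a : EReal}
    (h : ∀ q : ℝ, 0 < q → q < 1 → exponentAt r s P q ≤ a) : tau r s P ≤ a :=
  le_of_tendsto (tendsto_exponentAt r s P)
    (eventually_mem_Ioo_nhdsLT_one.mono fun q hq => h q hq.1 hq.2)

/-- The exponent is nonnegative for a property that the empty hypergraph does not have. -/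
theorem zero_le_exponentAt {r s : ℕ} {P : ∀ n, MultiHypergraph n → Prop}
    (hP : ∀ n, ¬ P n 0) {q : ℝ} (hq : 0 < q) : 0 ≤ exponentAt r s P q := by
  refine le_exponentAt (c := 1) (a := 0) one_pos (Eventually.of_forall fun n => ?_)
  have : (1 : ℕ∞) ≤ optTime n r s (P n) q := by
    refine le_iInf fun S => le_iInf fun t => le_iInf fun h => ?_
    rw [Order.one_le_iff_ne_zero]
    intro h0
    have h0' : t = 0 := by exact_mod_cast h0
    subst h0'
    rw [successProb_eq_expect, historyLaw, expect_pure, Set.indicator_of_notMem] at h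
    · simp [hq.not_ge] at h
    · exact hP n
  simpa using ENat.toENNReal_le.2 this

/-! ### Upper bounds: optimal play -/

open Classical in
/-- The probability of not reaching `G` within `T` further rounds from a given history,
under optimal play. -/
def failProb {n : ℕ} (r s : ℕ) (G : History n → Prop) : ℕ → History n → ℝ
  | 0, h => if G h then 0 else 1
  | T + 1, h => (∑ U ∈ powersetCard r (univ : Finset (Fin n)),
      ⨅ V : {V : Finset (Fin n) // #V = s - r}, failProb r s G T ((U, V.1) :: h)) / n.choose r

theorem nonempty_replies {n r s : ℕ} (hn : s ≤ n) :
    Nonempty {V : Finset (Fin n) // #V = s - r} := by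
  obtain ⟨V, -, hV⟩ := exists_subset_card_eq (s := (univ : Finset (Fin n))) (n := s - r)
    (by simp only [card_univ, Fintype.card_fin]; omega)
  exact ⟨V, hV⟩

theorem sum_powersetCard_div_le {n r : ℕ} (hn : r ≤ n) (f : Finset (Fin n) → ℝ) (c : ℝ)
    (hf : ∀ U ∈ powersetCard r (univ : Finset (Fin n)), f U ≤ c) :
    (∑ U ∈ powersetCard r (univ : Finset (Fin n)), f U) / n.choose r ≤ c := by
  have hc : (0 : ℝ) < n.choose r := by exact_mod_cast Nat.choose_pos hn
  rw [div_le_iff₀ hc]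
  refine (sum_le_card_nsmul _ _ _ hf).trans_eq ?_
  rw [card_powersetCard, card_univ, Fintype.card_fin, nsmul_eq_mul, mul_comm]

theorem failProb_nonneg {n r s : ℕ} (hn : s ≤ n) (G : History n → Prop) (T : ℕ) (h : History n) :
    0 ≤ failProb r s G T h := by
  have := nonempty_replies (r := r) hn
  induction T generalizing h with
  | zero => rw [failProb]; split_ifs <;> norm_num
  | succ T ih =>
    rw [failProb]
    exact div_nonneg (sum_nonneg fun U _ => le_ciInf fun V => ih _) (by positivity)

theorem iInf_failProb_le {n r s : ℕ} (G : History n → Prop) (T : ℕ) (h : History n)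
    (U : Finset (Fin n)) {V : Finset (Fin n)} (hV : #V = s - r) :
    ⨅ V : {V : Finset (Fin n) // #V = s - r}, failProb r s G T ((U, V.1) :: h) ≤
      failProb r s G T ((U, V) :: h) :=
  ciInf_le (Set.finite_range _).bddBelow (⟨V, hV⟩ : {V : Finset (Fin n) // #V = s - r})

theorem failProb_le_one {n r s : ℕ} (hrs : r ≤ s) (hn : s ≤ n) (G : History n → Prop) (T : ℕ)
    (h : History n) : failProb r s G T h ≤ 1 := by
  obtain ⟨V, hV⟩ := nonempty_replies (r := r) hn
  induction T generalizing h with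
  | zero => rw [failProb]; split_ifs <;> norm_num
  | succ T ih =>
    rw [failProb]
    exact sum_powersetCard_div_le (hrs.trans hn) _ _ fun U _ =>
      (iInf_failProb_le G T h U hV).trans (ih _)

/-- From every history in `Q`, the probability of not reaching `G` within `T` further rounds is at
most `E / T` under optimal play. -/
def ReachesWithin {n : ℕ} (r s : ℕ) (G Q : History n → Prop) (E : ℝ) : Prop :=
  ∀ T h, Q h → T * failProb r s G T h ≤ E

/-- The goal persists once reached, so the failure probability is 0 from then on. -/
theorem ReachesWithin.refl {n r s : ℕ} (hrs : r ≤ s) (hn : s ≤ n) {G : History n → Prop}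
    (hG : ∀ h p, G h → G (p :: h)) : ReachesWithin r s G G 0 := by
  obtain ⟨V, hV⟩ := nonempty_replies (r := r) hn
  intro T h hh
  refine mul_nonpos_of_nonneg_of_nonpos (by positivity) ?_
  induction T generalizing h with
  | zero => rw [failProb, if_pos hh]
  | succ T ih =>
    rw [failProb]
    exact sum_powersetCard_div_le (hrs.trans hn) _ _ fun U _ =>
      (iInf_failProb_le G T h U hV).trans (ih _ (hG _ _ hh))

theorem ReachesWithin.mono {n r s : ℕ} {G Q Q' : History n → Prop} {E E' : ℝ}
    (h : ReachesWithin r s G Q' E') (hQ : ∀ h, Q h → Q' h) (hE : E' ≤ E) :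
    ReachesWithin r s G Q E := fun T k hk => (h T k (hQ k hk)).trans hE

/-- If in each round one can pass from `Q` to `Q'` with probability at least `p`, then this takes
`1 / p` rounds on average. -/
theorem ReachesWithin.step {n r s : ℕ} (hrs : r ≤ s) (hn : s ≤ n) {G Q Q' : History n → Prop}
    {E p : ℝ} (hE : 0 ≤ E) (hp : 0 < p) (hQ : ∀ h p, Q h → Q (p :: h))
    (hstep : ∀ h, Q h → ∃ 𝒰 ⊆ powersetCard r (univ : Finset (Fin n)), n.choose r * p ≤ #𝒰 ∧
      ∀ U ∈ 𝒰, ∃ V, #V = s - r ∧ Q' ((U, V) :: h))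
    (h' : ReachesWithin r s G Q' E) : ReachesWithin r s G Q (E + 1 / p) := by
  have hc : (0 : ℝ) < n.choose r := by exact_mod_cast Nat.choose_pos (hrs.trans hn)
  obtain ⟨V₀, hV₀⟩ := nonempty_replies (r := r) hn
  classical
  intro T
  induction T with
  | zero => intro h _; rw [Nat.cast_zero, zero_mul]; positivity
  | succ T ih =>
    intro h hh
    obtain ⟨𝒢, h𝒢, hg, hgood⟩ := hstep h hh
    have hf1 := failProb_le_one hrs hn G (T + 1) h
    -- For such short horizons the claim is trivial, as a probability is at most 1.
    by_cases hcase : (T + 1 : ℝ) ≤ E + 1 / p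
    · refine le_trans ?_ hcase
      push_cast
      nlinarith
    push Not at hcase
    -- Only needed for `T > 0`: it gives `1 / p ≥ 1`, hence `T + 1 > 1`.
    have hp1 : p ≤ 1 := by
      have : (#𝒢 : ℝ) ≤ n.choose r := by
        have := card_le_card h𝒢
        rw [card_powersetCard, card_univ, Fintype.card_fin] at this
        exact_mod_cast this
      by_contra hcon
      push Not at hcon
      nlinarith
    have hT : (0 : ℝ) < T := by
      have : 1 ≤ 1 / p := by rw [le_div_iff₀ hp]; linarith
      linarith
    -- A good `U` leads to `Q'`, with failure at most `E / T`; any other `U` stays in `Q`, with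
    -- failure at most `(E + 1 / p) / T` by induction. Each good set thus saves `1 / p / T`, and
    -- their density is at least `p`, so the average saving is at least `1 / T`.
    have hsum : ∑ U ∈ powersetCard r (univ : Finset (Fin n)),
        ⨅ V : {V : Finset (Fin n) // #V = s - r}, failProb r s G T ((U, V.1) :: h) ≤
        n.choose r * ((E + 1 / p) / T) - #𝒢 * (1 / p / T) := by
      calc _ ≤ ∑ U ∈ powersetCard r (univ : Finset (Fin n)),
            ((E + 1 / p) / T - if U ∈ 𝒢 then 1 / p / T else 0) := by
            refine sum_le_sum fun U hU => ?_
            by_cases hUg : U ∈ 𝒢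
            · rw [if_pos hUg, ← sub_div, add_sub_cancel_right, le_div_iff₀ hT, mul_comm]
              obtain ⟨V, hV, hq⟩ := hgood U hUg
              exact (mul_le_mul_of_nonneg_left (iInf_failProb_le G T h U hV) hT.le).trans
                (h' T _ hq)
            · rw [if_neg hUg, sub_zero, le_div_iff₀ hT, mul_comm]
              exact (mul_le_mul_of_nonneg_left (iInf_failProb_le G T h U hV₀) hT.le).trans
                (ih _ (hQ _ _ hh))
        _ = _ := by
            rw [sum_sub_distrib, sum_const, card_powersetCard, card_univ, Fintype.card_fin,
              nsmul_eq_mul, ← sum_filter, sum_const, nsmul_eq_mul]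
            rw [filter_mem_eq_inter, inter_eq_right.2 h𝒢]
    have hfail : failProb r s G (T + 1) h ≤ (E + 1 / p) / T - 1 / T := by
      rw [failProb, div_le_iff₀ hc]
      refine hsum.trans ?_
      have : n.choose r * (1 / T : ℝ) ≤ #𝒢 * (1 / p / T) := by
        calc n.choose r * (1 / T : ℝ) = (n.choose r * p) * (1 / p / T) := by field_simp
          _ ≤ _ := by gcongr
      linarith
    calc ((T + 1 : ℕ) : ℝ) * failProb r s G (T + 1) h
        ≤ ((T + 1 : ℕ) : ℝ) * ((E + 1 / p) / T - 1 / T) := by gcongr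
      -- In the present case `E + 1 / p < T + 1`, so the second summand is negative.
      _ = ((E + 1 / p) * T + ((E + 1 / p) - (T + 1))) / T := by push_cast; field_simp; ring
      _ ≤ _ := by rw [div_le_iff₀ hT]; linarith

/-- Iteration of `ReachesWithin.step`, with probability `1 / 2` for each step. -/
theorem ReachesWithin.iterate {n r s : ℕ} (hrs : r ≤ s) (hn : s ≤ n) {G : History n → Prop}
    {E : ℝ} (hE : 0 ≤ E) (Q : ℕ → History n → Prop) (M : ℕ)
    (hQ : ∀ k < M, ∀ h p, Q k h → Q k (p :: h))
    (hstep : ∀ k < M, ∀ h, Q k h →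
      ∃ 𝒰 ⊆ powersetCard r (univ : Finset (Fin n)), (n.choose r : ℝ) ≤ 2 * #𝒰 ∧
        ∀ U ∈ 𝒰, ∃ V, #V = s - r ∧ Q (k + 1) ((U, V) :: h))
    (h' : ReachesWithin r s G (Q M) E) : ReachesWithin r s G (Q 0) (E + 2 * M) := by
  induction M generalizing E with
  | zero => simpa using h'
  | succ M ih =>
    have := ReachesWithin.step (p := 1 / 2) hrs hn hE (by norm_num) (hQ M (by omega))
      (fun h hh => by
        obtain ⟨𝒰, h1, h2, h3⟩ := hstep M (by omega) h hh
        exact ⟨𝒰, h1, by linarith, h3⟩) h'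
    refine (ih (by positivity) (fun k hk => hQ k (by omega)) (fun k hk => hstep k (by omega))
      this).mono (fun _ => id) (le_of_eq ?_)
    push_cast
    ring

/-- The strategy plays a minimising reply, which exists because there are finitely many. The length
of the history tells it how many of the `T` rounds remain. -/
theorem exists_strategy_le_failProb {n r s : ℕ} (hrs : r ≤ s) (hn : s ≤ n)
    (G : History n → Prop) (T : ℕ) : ∃ S : Strategy n r s,
      expect (historyLaw S T) ({h | ¬ G h}.indicator 1) ≤
        ENNReal.ofReal (failProb r s G T []) := by
  have hne := nonempty_replies (r := r) hn
  have hc : (0 : ℝ) < n.choose r := by exact_mod_cast Nat.choose_pos (hrs.trans hn)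
  have hex : ∀ (h : History n) (U : Finset (Fin n)),
      ∃ V : {V : Finset (Fin n) // #V = s - r},
        failProb r s G (T - h.length - 1) ((U, V.1) :: h) =
          ⨅ V : {V : Finset (Fin n) // #V = s - r},
            failProb r s G (T - h.length - 1) ((U, V.1) :: h) :=
    fun h U => exists_eq_ciInf_of_finite
  choose V hV using hex
  let S : Strategy n r s :=
    { reply := fun h U => PMF.pure (V h U).1
      card_of_mem_support := fun h U W hW => by
        rw [PMF.support_pure, Set.mem_singleton_iff] at hW
        rw [hW]; exact (V h U).2 }
  -- Under this strategy the failure probability for the remaining rounds is a martingale; at `t =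
  -- T` it is the indicator of failure.
  have key : ∀ t ≤ T, expect (historyLaw S t)
      (fun h => ENNReal.ofReal (failProb r s G (T - t) h)) ≤
        ENNReal.ofReal (failProb r s G T []) := by
    intro t
    induction t with
    | zero => intro _; rw [historyLaw, expect_pure]; rfl
    | succ t ih =>
      intro ht
      rw [expect_historyLaw_succ]
      refine le_trans (expect_mono _ fun h hh => ?_) (ih (by omega))
      have hl := (valid_of_mem_support (hrs.trans hn) S t h hh).1
      have e1 : T - t = (T - (t + 1)) + 1 := by omega
      have e2 : T - h.length - 1 = T - (t + 1) := by omega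
      rw [e1, failProb, expect_uniformSubset (hrs.trans hn), ENNReal.ofReal_div_of_pos hc,
        ENNReal.ofReal_natCast, ENNReal.ofReal_sum_of_nonneg
          (fun U _ => le_ciInf fun V => failProb_nonneg hn _ _ _)]
      refine le_of_eq ?_
      congr 1
      refine sum_congr rfl fun U _ => ?_
      have := hV h U
      rw [e2] at this
      rw [show S.reply h U = PMF.pure (V h U).1 from rfl, expect_pure, this]
  refine ⟨S, le_trans (expect_mono _ fun h _ => ?_) (key T le_rfl)⟩
  rw [Nat.sub_self, failProb]
  by_cases hG : G h <;> simp [hG]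

/-- The Markov-type step: the failure probability after `T` rounds is at most `E / T ≤ 1 - q`. -/
theorem optTime_le_of_reachesWithin {n r s : ℕ} (hrs : r ≤ s) (hn : s ≤ n)
    {P : MultiHypergraph n → Prop} {Q : History n → Prop} {E : ℝ}
    (h : ReachesWithin r s (fun h => P h.hypergraph) Q E) (hQ : Q []) {q : ℝ} {T : ℕ}
    (hT : 0 < T) (hE : E ≤ (1 - q) * T) : optTime n r s P q ≤ T := by
  obtain ⟨S, hS⟩ := exists_strategy_le_failProb hrs hn (fun h => P h.hypergraph) T
  refine (iInf_le _ S).trans ((iInf_le _ T).trans (iInf_le _ ?_))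
  have hT' : (0 : ℝ) < T := by exact_mod_cast hT
  have h1 : failProb r s (fun h => P h.hypergraph) T [] ≤ 1 - q := by
    have := (h T [] hQ).trans hE
    rw [mul_comm] at this
    exact le_of_mul_le_mul_right this hT'
  have h2 : successProb S P T +
      expect (historyLaw S T) ({h : History n | ¬ P h.hypergraph}.indicator 1) = 1 := by
    rw [successProb_eq_expect, ← expect_add, ← expect_const (historyLaw S T) 1]
    congr 1
    funext h
    by_cases hG : P h.hypergraph <;> simp [hG]
  have h3 := hS.trans (ENNReal.ofReal_le_ofReal h1)
  have h4 : (1 : ℝ≥0∞) ≤ successProb S P T + ENNReal.ofReal (1 - q) := by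
    rw [← h2]; gcongr
  have h0 := failProb_nonneg (r := r) hn (fun h => P h.hypergraph) T []
  by_cases hq : 0 ≤ q
  · have h5 : ENNReal.ofReal q + ENNReal.ofReal (1 - q) ≤
        successProb S P T + ENNReal.ofReal (1 - q) := by
      rw [← ENNReal.ofReal_add hq (by linarith)]
      simpa using h4
    exact (ENNReal.add_le_add_iff_right ENNReal.ofReal_ne_top).1 h5
  · rw [ENNReal.ofReal_of_nonpos (by linarith)]; exact zero_le

/-! ### Coordinates on the loose cycle -/

theorem add_one_ne_self {m : ℕ} (hm : 2 ≤ m) (j : ZMod m) : j + 1 ≠ j := by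
  have : Fact (1 < m) := ⟨by omega⟩
  simp

theorem two_ne_zero_zmod {m : ℕ} (hm : 3 ≤ m) : (1 + 1 : ZMod m) ≠ 0 := by
  have : ((2 : ℕ) : ZMod m) ≠ 0 := by
    rw [Ne, ZMod.natCast_eq_zero_iff]
    intro h
    have := Nat.le_of_dvd (by norm_num) h
    omega
  rw [one_add_one_eq_two]
  exact_mod_cast this

/-- The position of a vertex of the loose cycle. -/
def pos (m d : ℕ) (v : ZMod m × Fin d) : ZMod (d * m) := ((v.1.val * d + v.2.val : ℕ) : ZMod (d * m))

/-- Here `a` need not be reduced modulo `m`, which handles the wrap-around from the last block to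
the first. -/
theorem pos_natCast {m d : ℕ} (a : ℕ) (i : Fin d) :
    pos m d ((a : ZMod m), i) = ((a * d + i.val : ℕ) : ZMod (d * m)) := by
  rw [pos, ZMod.natCast_eq_natCast_iff]
  refine Nat.ModEq.add_right _ ?_
  rw [ZMod.val_natCast, mul_comm (a % m), mul_comm a]
  exact Nat.ModEq.mul_left' d (Nat.mod_modEq a m)

section Coordinates

variable {m d : ℕ} [NeZero m]

/-- The vertices shared by the edges `j - 1` and `j`. -/
def link (ℓ : ℕ) (j : ZMod m) : Finset (ZMod m × Fin d) := {v | v.1 = j ∧ v.2.val < ℓ}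

/-- The vertices that are only on the edge `j`. -/
def inner (ℓ : ℕ) (j : ZMod m) : Finset (ZMod m × Fin d) := {v | v.1 = j ∧ ℓ ≤ v.2.val}

/-- The edge `j` of the loose cycle. -/
def cycEdge (ℓ : ℕ) (j : ZMod m) : Finset (ZMod m × Fin d) :=
  link ℓ j ∪ inner ℓ j ∪ link ℓ (j + 1)

theorem mem_link {ℓ : ℕ} {j : ZMod m} {v : ZMod m × Fin d} :
    v ∈ link ℓ j ↔ v.1 = j ∧ v.2.val < ℓ := by simp [link]

theorem mem_inner {ℓ : ℕ} {j : ZMod m} {v : ZMod m × Fin d} :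
    v ∈ inner ℓ j ↔ v.1 = j ∧ ℓ ≤ v.2.val := by simp [inner]

theorem mem_cycEdge {ℓ : ℕ} {j : ZMod m} {v : ZMod m × Fin d} :
    v ∈ cycEdge ℓ j ↔ v.1 = j ∨ (v.1 = j + 1 ∧ v.2.val < ℓ) := by
  simp only [cycEdge, mem_union, mem_link, mem_inner]
  have := lt_or_ge v.2.val ℓ
  tauto

theorem card_link {ℓ : ℕ} (hℓ : ℓ ≤ d) (j : ZMod m) :
    #(link ℓ j : Finset (ZMod m × Fin d)) = ℓ := by
  have : (link ℓ j : Finset (ZMod m × Fin d)) = {j} ×ˢ ({i | i.val < ℓ} : Finset (Fin d)) := by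
    ext v; simp [mem_link, -singleton_product]
  rw [this, card_product, card_singleton, one_mul, Fin.card_filter_val_lt]
  omega

theorem card_inner {ℓ : ℕ} (hℓ : ℓ ≤ d) (j : ZMod m) :
    #(inner ℓ j : Finset (ZMod m × Fin d)) = d - ℓ := by
  have : (inner ℓ j : Finset (ZMod m × Fin d)) =
      {j} ×ˢ ({i | i.val < ℓ} : Finset (Fin d))ᶜ := by
    ext v; simp [mem_inner, -singleton_product]
  rw [this, card_product, card_singleton, one_mul, card_compl, Fin.card_filter_val_lt,
    Fintype.card_fin]
  omega

theorem disjoint_link_inner (ℓ : ℕ) (j j' : ZMod m) :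
    Disjoint (link ℓ j : Finset (ZMod m × Fin d)) (inner ℓ j') := by
  rw [disjoint_left]
  intro v h h'
  rw [mem_link] at h
  rw [mem_inner] at h'
  omega

theorem disjoint_link_link {ℓ : ℕ} {j j' : ZMod m} (h : j ≠ j') :
    Disjoint (link ℓ j : Finset (ZMod m × Fin d)) (link ℓ j') := by
  rw [disjoint_left]
  intro v h1 h2
  rw [mem_link] at h1 h2
  exact h (h1.1.symm.trans h2.1)

theorem disjoint_inner_inner {ℓ : ℕ} {j j' : ZMod m} (h : j ≠ j') :
    Disjoint (inner ℓ j : Finset (ZMod m × Fin d)) (inner ℓ j') := by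
  rw [disjoint_left]
  intro v h1 h2
  rw [mem_inner] at h1 h2
  exact h (h1.1.symm.trans h2.1)

theorem card_cycEdge {ℓ : ℕ} (hℓ : ℓ ≤ d) (hm : 2 ≤ m) (j : ZMod m) :
    #(cycEdge ℓ j : Finset (ZMod m × Fin d)) = d + ℓ := by
  rw [cycEdge, card_union_of_disjoint, card_union_of_disjoint (disjoint_link_inner _ _ _),
    card_link hℓ, card_link hℓ, card_inner hℓ]
  · omega
  · rw [disjoint_union_left]
    exact ⟨disjoint_link_link (add_one_ne_self hm j).symm, (disjoint_link_inner _ _ _).symm⟩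

/-- The vertex at offset 0 of block `a` lies on the edges `a` and `a - 1` only. So an edge
determines the pair `{j, j + 1}`, and for `m ≥ 3` the pair determines `j`. -/
theorem cycEdge_injective {ℓ : ℕ} (h0 : 1 ≤ ℓ) (hℓ : ℓ ≤ d) (hm : 3 ≤ m) :
    Function.Injective (cycEdge ℓ : ZMod m → Finset (ZMod m × Fin d)) := by
  intro j j' he
  have key : ∀ a b : ZMod m, (a, (⟨0, by omega⟩ : Fin d)) ∈ (cycEdge ℓ b : Finset (ZMod m × Fin d)) ↔
      (a = b ∨ a = b + 1) := fun a b => by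
    rw [mem_cycEdge]
    simp only [and_iff_left (show 0 < ℓ from h0)]
  have h1 := (key j j').1 (he ▸ (key j j).2 (Or.inl rfl))
  have h2 := (key (j + 1) j').1 (he ▸ (key (j + 1) j).2 (Or.inr rfl))
  rcases h1 with h1 | h1
  · exact h1
  · rcases h2 with h2 | h2
    · rw [h1, add_assoc] at h2
      exact absurd (by simpa using h2) (two_ne_zero_zmod hm)
    · exact add_right_cancel h2

theorem pos_bijective (hd : 1 ≤ d) : Function.Bijective (pos m d) := by
  have hm0 : 0 < m := Nat.pos_of_ne_zero (NeZero.ne m)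
  have : NeZero (d * m) := ⟨by positivity⟩
  rw [Fintype.bijective_iff_injective_and_card]
  constructor
  · rintro ⟨a, i⟩ ⟨b, k⟩ h
    have hlt : ∀ (a : ZMod m) (i : Fin d), a.val * d + i.val < d * m := fun a i => by
      have := ZMod.val_lt a
      have := i.2
      nlinarith
    rw [pos, pos, ZMod.natCast_eq_natCast_iff', Nat.mod_eq_of_lt (hlt a i),
      Nat.mod_eq_of_lt (hlt b k)] at h
    have h1 : i.val = k.val := by
      have := congrArg (· % d) h
      simpa [Nat.mul_add_mod', Nat.mod_eq_of_lt i.2, Nat.mod_eq_of_lt k.2] using this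
    have h2 : a.val = b.val := by
      rw [h1] at h
      exact Nat.eq_of_mul_eq_mul_right hd (Nat.add_right_cancel h)
    exact Prod.ext (ZMod.val_injective m h2) (Fin.ext h1)
  · simp [ZMod.card, mul_comm]

/-- A segment starting at a multiple of `d` runs through block `j` and then the first `ℓ` places of
block `j + 1`. -/
theorem pos_image_cycEdge {ℓ : ℕ} (hℓ : ℓ ≤ d) (j : ZMod m) :
    pos m d '' (cycEdge ℓ j : Finset (ZMod m × Fin d)) =
      {v | ∃ i < d + ℓ, v = ((j.val * d + i : ℕ) : ZMod (d * m))} := by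
  ext v
  simp only [Set.mem_image, mem_coe, mem_cycEdge]
  constructor
  · rintro ⟨⟨a, i⟩, h, rfl⟩
    rcases h with rfl | ⟨rfl, hi⟩
    · exact ⟨i, by have := i.2; omega, rfl⟩
    · simp only at hi
      refine ⟨d + i, by omega, ?_⟩
      have := pos_natCast (m := m) (j.val + 1) i
      rw [Nat.cast_add, ZMod.natCast_zmod_val, Nat.cast_one] at this
      rw [this]
      congr 1
      ring
  · rintro ⟨i, hi, rfl⟩
    by_cases hid : i < d
    · exact ⟨(j, ⟨i, hid⟩), Or.inl rfl, rfl⟩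
    · refine ⟨(j + 1, ⟨i - d, by omega⟩), Or.inr ⟨rfl, by simp only; omega⟩, ?_⟩
      have := pos_natCast (m := m) (d := d) (j.val + 1) ⟨i - d, by omega⟩
      rw [Nat.cast_add, ZMod.natCast_zmod_val, Nat.cast_one] at this
      rw [this]
      congr 1
      simp only [add_mul, one_mul]
      omega

theorem looseCycle_edgeSet {s ℓ : ℕ} (hs : 2 * ℓ ≤ s) :
    (looseCycle s ℓ m).edgeSet = Set.range fun j : ZMod m =>
      pos m (s - ℓ) '' (cycEdge ℓ j : Finset (ZMod m × Fin (s - ℓ))) := by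
  ext e
  simp only [looseCycle, Set.mem_range, Set.mem_ofPred_eq]
  constructor
  · rintro ⟨j, hj, rfl⟩
    refine ⟨(j : ZMod m), ?_⟩
    rw [pos_image_cycEdge (by omega), ZMod.val_natCast, Nat.mod_eq_of_lt hj,
      show s - ℓ + ℓ = s by omega]
  · rintro ⟨j, rfl⟩
    refine ⟨j.val, ZMod.val_lt j, ?_⟩
    rw [pos_image_cycEdge (by omega), show s - ℓ + ℓ = s by omega]

theorem ncard_edgeSet_looseCycle {s ℓ : ℕ} (h0 : 1 ≤ ℓ) (hs : 2 * ℓ ≤ s) (hm : 3 ≤ m) :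
    (looseCycle s ℓ m).edgeSet.ncard = m := by
  rw [looseCycle_edgeSet hs, Set.ncard_range_of_injective, Nat.card_zmod]
  intro j j' h
  refine cycEdge_injective h0 (by omega : ℓ ≤ s - ℓ) hm (coe_injective ?_)
  exact (Set.image_injective.2 (pos_bijective (by omega)).1) h

/-- A set is an edge without repeated vertices of the hypergraph built along a history. -/
def IsEdge {n : ℕ} (h : History n) (f : Finset (Fin n)) : Prop :=
  ∃ p ∈ h, Disjoint p.1 p.2 ∧ p.1 ∪ p.2 = f

theorem IsEdge.cons {n : ℕ} {h : History n} {f : Finset (Fin n)} (hf : IsEdge h f)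
    (p : Finset (Fin n) × Finset (Fin n)) : IsEdge (p :: h) f := by
  obtain ⟨a, ha, h⟩ := hf
  exact ⟨a, List.mem_cons_of_mem _ ha, h⟩

theorem isEdge_iff {n : ℕ} (h : History n) (f : Finset (Fin n)) :
    IsEdge h f ↔ ∃ g ∈ h.hypergraph, g.Nodup ∧ {v | v ∈ g} = (f : Set (Fin n)) := by
  simp only [IsEdge, History.hypergraph, Multiset.mem_coe, List.mem_map]
  constructor
  · rintro ⟨p, hp, hd, rfl⟩
    refine ⟨_, ⟨p, hp, rfl⟩, ?_, ?_⟩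
    · exact Multiset.Nodup.add_iff p.1.2 p.2.2 |>.2 (disjoint_val.2 hd)
    · ext v; simp
  · rintro ⟨g, ⟨p, hp, rfl⟩, hn, hg⟩
    refine ⟨p, hp, ?_, ?_⟩
    · exact disjoint_val.1 ((Multiset.Nodup.add_iff p.1.2 p.2.2).1 hn)
    · rw [← coe_inj, ← hg]; ext v; simp

/-- The passage from residues to block coordinates, in which links and inner parts are explicit and
edges are finsets. -/
theorem containsCopy_looseCycle_iff {s ℓ n : ℕ} (h0 : 1 ≤ ℓ) (hs : 2 * ℓ ≤ s) (h : History n) :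
    ContainsCopy (looseCycle s ℓ m) n h.hypergraph ↔
      ∃ φ : ZMod m × Fin (s - ℓ) → Fin n, Function.Injective φ ∧
        ∀ j : ZMod m, IsEdge h ((cycEdge ℓ j).image φ) := by
  have hb := pos_bijective (m := m) (d := s - ℓ) (by omega)
  simp only [ContainsCopy, looseCycle_edgeSet hs, Set.forall_mem_range, isEdge_iff]
  have hu : (looseCycle s ℓ m).vertexSet = Set.univ := rfl
  constructor
  · rintro ⟨ψ, hψ, hE⟩
    rw [hu, Set.injOn_univ] at hψ
    refine ⟨ψ ∘ pos m (s - ℓ), hψ.comp hb.1, fun j => ?_⟩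
    rw [coe_image, Set.image_comp]
    exact hE j
  · rintro ⟨φ, hφ, hE⟩
    let e := Equiv.ofBijective _ hb
    refine ⟨φ ∘ e.symm, (hφ.comp e.symm.injective).injOn, fun j => ?_⟩
    have h2 := hE j
    rw [coe_image] at h2
    have : (φ ∘ e.symm) '' (pos m (s - ℓ) '' (cycEdge ℓ j : Finset (ZMod m × Fin (s - ℓ)))) =
        φ '' (cycEdge ℓ j : Finset (ZMod m × Fin (s - ℓ))) := by
      rw [← Set.image_comp]
      refine Set.image_congr fun v _ => ?_
      show φ (e.symm (e v)) = φ v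
      rw [e.symm_apply_apply]
    rw [this]
    exact h2

/-- Consider the last edge of a copy of the loose cycle: its random part meets the two
neighbouring edges in many vertices. -/
theorem hasHit_of_isEdge {r s ℓ x n : ℕ} (h0 : 1 ≤ ℓ) (hℓ : ℓ ≤ d) (hm : 3 ≤ m)
    (hx : x + (d - ℓ) ≤ r) {φ : ZMod m × Fin d → Fin n} (hφ : Function.Injective φ)
    (h : History n) (hv : Valid r s h)
    (hE : ∀ j : ZMod m, IsEdge h ((cycEdge ℓ j).image φ)) : HasHit x h := by
  induction h with
  | nil =>
    obtain ⟨p, hp, -⟩ := hE 0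
    simp at hp
  | cons p h ih =>
    -- The induction goes back to the round that completes this copy: there some edge `j` comes from
    -- `p` and from no earlier round.
    by_cases hall : ∀ j : ZMod m, IsEdge h ((cycEdge ℓ j).image φ)
    · exact Or.inl (ih (fun q hq => hv q (List.mem_cons_of_mem _ hq)) hall)
    right
    push Not at hall
    obtain ⟨j, hj⟩ := hall
    have hpj : p.1 ∪ p.2 = (cycEdge ℓ j).image φ := by
      obtain ⟨q, hq, hd, he⟩ := hE j
      rcases List.mem_cons.1 hq with rfl | hq
      · exact he
      · exact absurd ⟨q, hq, hd, he⟩ hj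
    -- The pair `p` realises the edge `j` and hence no other, so all other edges were there before.
    have hother : ∀ i : ZMod m, i ≠ j → ∃ a ∈ h, a.1 ∪ a.2 = (cycEdge ℓ i).image φ := by
      intro i hi
      obtain ⟨q, hq, hd, he⟩ := hE i
      rcases List.mem_cons.1 hq with rfl | hq
      · rw [hpj] at he
        exact absurd (cycEdge_injective h0 hℓ hm (image_injective hφ he)).symm hi
      · exact ⟨q, hq, he⟩
    obtain ⟨a, ha, hae⟩ := hother (j - 1) (fun h => add_one_ne_self (m := m) (by omega) (j - 1)
      (by rw [sub_add_cancel]; exact h.symm))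
    obtain ⟨b, hb, hbe⟩ := hother (j + 1) (add_one_ne_self (by omega) j)
    refine ⟨a, ha, b, hb, ?_⟩
    rw [hae, hbe]
    -- Edge `j` minus its inner part is `link j`, contained in edge `j - 1`, together with `link (j
    -- + 1)`, contained in edge `j + 1`.
    have hsub : p.1 ⊆ (p.1 ∩ ((cycEdge ℓ (j - 1)).image φ ∪ (cycEdge ℓ (j + 1)).image φ)) ∪
        (inner ℓ j).image φ := by
      intro v hv
      have hv' : v ∈ (cycEdge ℓ j).image φ := by rw [← hpj]; exact mem_union_left _ hv
      obtain ⟨w, hw, rfl⟩ := mem_image.1 hv'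
      rw [cycEdge, mem_union, mem_union] at hw
      rcases hw with (hw | hw) | hw
      · refine mem_union_left _ (mem_inter.2 ⟨hv, mem_union_left _ (mem_image_of_mem _ ?_)⟩)
        rw [cycEdge, sub_add_cancel]
        exact mem_union_right _ hw
      · exact mem_union_right _ (mem_image_of_mem _ hw)
      · refine mem_union_left _ (mem_inter.2 ⟨hv, mem_union_right _ (mem_image_of_mem _ ?_)⟩)
        exact mem_union_left _ (mem_union_left _ hw)
    have h1 := (card_le_card hsub).trans (card_union_le _ _)
    have h2 : #((inner ℓ j).image φ) ≤ d - ℓ := card_image_le.trans_eq (card_inner hℓ j)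
    have h3 := (hv p List.mem_cons_self).1
    omega

end Coordinates

/-! ### Building a hypergraph edge by edge -/

/-- Disjoint sets of points can be given new images under an injection. -/
theorem exists_relabel {α β ι : Type*} [DecidableEq α] [DecidableEq β] {φ : α → β}
    (hφ : Function.Injective φ) (S : ι → Finset α) (T : ι → Finset β)
    (hS : ∀ i j, i ≠ j → Disjoint (S i) (S j)) (hT : ∀ i j, i ≠ j → Disjoint (T i) (T j))
    (hST : ∀ i, #(S i) = #(T i)) (hφT : ∀ i a, φ a ∉ T i) :
    ∃ φ' : α → β, Function.Injective φ' ∧ (∀ a, (∀ i, a ∉ S i) → φ' a = φ a) ∧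
      ∀ i, (S i).image φ' = T i := by
  classical
  have e : ∀ i, S i ≃ T i := fun i => equivOfCardEq (hST i)
  let φ' : α → β := fun a => if h : ∃ i, a ∈ S i then (e h.choose ⟨a, h.choose_spec⟩).1 else φ a
  have h1 : ∀ i a (ha : a ∈ S i), φ' a = (e i ⟨a, ha⟩).1 := by
    intro i a ha
    have h : ∃ i, a ∈ S i := ⟨i, ha⟩
    have hi : h.choose = i := by
      by_contra hne
      exact disjoint_left.1 (hS _ _ hne) h.choose_spec ha
    have : ∀ j (hj : a ∈ S j), j = i → (e j ⟨a, hj⟩).1 = (e i ⟨a, ha⟩).1 := by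
      rintro j hj rfl; rfl
    simp only [φ', dif_pos h]
    exact this _ _ hi
  have h2 : ∀ a, (∀ i, a ∉ S i) → φ' a = φ a := fun a ha => by
    have h : ¬ ∃ i, a ∈ S i := fun ⟨i, hi⟩ => ha i hi
    simp only [φ', dif_neg h]
  refine ⟨φ', ?_, h2, ?_⟩
  · intro a b hab
    by_cases ha : ∃ i, a ∈ S i
    · obtain ⟨i, ha⟩ := ha
      by_cases hb : ∃ j, b ∈ S j
      · obtain ⟨j, hb⟩ := hb
        rw [h1 i a ha, h1 j b hb] at hab
        have hij : i = j := by
          by_contra hne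
          exact disjoint_left.1 (hT _ _ hne) (e i ⟨a, ha⟩).2 (hab ▸ (e j ⟨b, hb⟩).2)
        subst hij
        have := (e i).injective (Subtype.ext hab)
        exact congrArg Subtype.val this
      · rw [h1 i a ha, h2 b (fun j hj => hb ⟨j, hj⟩)] at hab
        exact absurd (hab ▸ (e i ⟨a, ha⟩).2) (hφT i b)
    · by_cases hb : ∃ j, b ∈ S j
      · obtain ⟨j, hb⟩ := hb
        rw [h2 a (fun j hj => ha ⟨j, hj⟩), h1 j b hb] at hab
        exact absurd (hab.symm ▸ (e j ⟨b, hb⟩).2) (hφT j a)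
      · rw [h2 a (fun j hj => ha ⟨j, hj⟩), h2 b (fun j hj => hb ⟨j, hj⟩)] at hab
        exact hφ hab
  · intro i
    refine eq_of_subset_of_card_le (fun v hv => ?_) ?_
    · obtain ⟨a, ha, rfl⟩ := mem_image.1 hv
      rw [h1 i a ha]
      exact (e i ⟨a, ha⟩).2
    · rw [← hST i, card_image_of_injOn]
      intro a ha b hb hab
      rw [h1 i a ha, h1 i b hb] at hab
      exact congrArg Subtype.val ((e i).injective (Subtype.ext hab))

/-- The first `k` edges of the sequence `e` are embedded. -/
def Embeds {α : Type*} {n : ℕ} (e : ℕ → Finset α) (k : ℕ) (φ : α → Fin n) (h : History n) :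
    Prop :=
  Function.Injective φ ∧ ∀ i < k, IsEdge h ((e i).image φ)

theorem Embeds.cons {α : Type*} {n : ℕ} {e : ℕ → Finset α} {k : ℕ} {φ : α → Fin n}
    {h : History n} (he : Embeds e k φ h) (p : Finset (Fin n) × Finset (Fin n)) :
    Embeds e k φ (p :: h) := ⟨he.1, fun i hi => (he.2 i hi).cons p⟩

/-- A random set of fresh vertices can be completed to a copy of the next edge. -/
theorem Embeds.exists_succ {α : Type*} [DecidableEq α] {n r s k : ℕ} {e : ℕ → Finset α}
    {φ : α → Fin n} {h : History n} (H : Embeds e k φ h) {S : Finset α} (he : #(e k) = s)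
    (hSe : S ⊆ e k) (hS : #S = r) (hd : ∀ i < k, Disjoint (e i) S) {U : Finset (Fin n)}
    (hUr : #U = r) (hU : ∀ a, φ a ∉ U) :
    ∃ V, #V = s - r ∧ ∃ φ' : α → Fin n, Embeds e (k + 1) φ' ((U, V) :: h) := by
  -- The vertices in `S` are on none of the first `k` edges, so their images under `φ` are mere
  -- placeholders and can be replaced by `U`.
  obtain ⟨φ', hφ', hoff, him⟩ := exists_relabel (ι := Unit) H.1 (fun _ => S) (fun _ => U)
    (fun i j hij => absurd rfl hij) (fun i j hij => absurd rfl hij)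
    (fun _ => hS.trans hUr.symm) (fun _ => hU)
  refine ⟨(e k \ S).image φ', ?_, φ', hφ', ?_⟩
  · rw [card_image_of_injective _ hφ', card_sdiff_of_subset hSe, he, hS]
  · intro i hi
    rcases Nat.lt_succ_iff_lt_or_eq.1 hi with hi | hi
    · have : (e i).image φ' = (e i).image φ :=
        image_congr fun a ha => hoff a fun _ => disjoint_left.1 (hd i hi) ha
      rw [this]
      exact (H.2 i hi).cons _
    · subst hi
      refine ⟨_, List.mem_cons_self, ?_, ?_⟩
      · rw [← him (), disjoint_image hφ']
        exact disjoint_sdiff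
      · rw [← him (), ← image_union, union_sdiff_of_subset hSe]

/-- If every edge has `r` vertices that are on no earlier edge, then each edge can be embedded in
a bounded number of rounds. -/
theorem ReachesWithin.embeds {α : Type*} [Fintype α] [DecidableEq α] {n r s M : ℕ} (hr : 1 ≤ r)
    (hrs : r ≤ s) (hn : s ≤ n) (hn' : 4 * r * (Fintype.card α + 1) ≤ n) (e S : ℕ → Finset α)
    (he : ∀ k < M, #(e k) = s) (hSe : ∀ k < M, S k ⊆ e k) (hS : ∀ k < M, #(S k) = r)
    (hd : ∀ k < M, ∀ i < k, Disjoint (e i) (S k)) {G : History n → Prop} {E : ℝ} (hE : 0 ≤ E)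
    (h : ReachesWithin r s G (fun h => ∃ φ : α → Fin n, Embeds e M φ h) E) :
    ReachesWithin r s G (fun h => ∃ φ : α → Fin n, Embeds e 0 φ h) (E + 2 * M) := by
  classical
  refine ReachesWithin.iterate hrs hn hE (fun k h => ∃ φ : α → Fin n, Embeds e k φ h) M
    (fun k _ h p ⟨φ, hφ⟩ => ⟨φ, hφ.cons p⟩) ?_ h
  rintro k hk h ⟨φ, H⟩
  have hD : #(univ.image φ) ≤ Fintype.card α := card_image_le
  have hn2 : 4 * r * (#(univ.image φ) + 1) ≤ n := le_trans (by gcongr) hn'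
  refine ⟨_, filter_subset _ _, choose_le_two_mul_card_filter_disjoint hr (univ.image φ) hn2,
    fun U hU => ?_⟩
  obtain ⟨hU1, hU2⟩ := mem_filter.1 hU
  exact H.exists_succ (he k hk) (hSe k hk) (hS k hk) (hd k hk) (mem_powersetCard.1 hU1).2
    (fun a ha => disjoint_left.1 hU2 ha (mem_image_of_mem φ (mem_univ a)))

/-! ### Petals -/

/-- A family of pairwise disjoint `d`-sets that avoid `D` and extend `R` to an edge. -/
structure PetalFamily {n : ℕ} (d : ℕ) (h : History n) (R D : Finset (Fin n))
    (𝒜 : Finset (Finset (Fin n))) : Prop where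
  card_eq : ∀ P ∈ 𝒜, #P = d
  avoids : ∀ P ∈ 𝒜, Disjoint P D
  isEdge : ∀ P ∈ 𝒜, IsEdge h (P ∪ R)
  pairwise : ∀ P ∈ 𝒜, ∀ P' ∈ 𝒜, P ≠ P' → Disjoint P P'

theorem PetalFamily.cons {n d : ℕ} {h : History n} {R D : Finset (Fin n)}
    {𝒜 : Finset (Finset (Fin n))} (H : PetalFamily d h R D 𝒜)
    (p : Finset (Fin n) × Finset (Fin n)) : PetalFamily d (p :: h) R D 𝒜 :=
  ⟨H.card_eq, H.avoids, fun P hP => (H.isEdge P hP).cons p, H.pairwise⟩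

theorem PetalFamily.card_biUnion {n d : ℕ} {h : History n} {R D : Finset (Fin n)}
    {𝒜 : Finset (Finset (Fin n))} (H : PetalFamily d h R D 𝒜) : #(𝒜.biUnion id) = #𝒜 * d := by
  have h1 : #(𝒜.biUnion id) = ∑ P ∈ 𝒜, #P := Finset.card_biUnion H.pairwise
  rw [h1]
  exact sum_const_nat H.card_eq

/-- A random set that avoids everything so far can be completed to a new petal. -/
theorem PetalFamily.exists_insert {n r d ℓ : ℕ} {h : History n} {R D : Finset (Fin n)}
    {𝒜 : Finset (Finset (Fin n))} (H : PetalFamily d h R D 𝒜) (hd : 1 ≤ d) (hrd : r ≤ d)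
    (hR : R ⊆ D) (hRℓ : #R = ℓ) (hn : #(D ∪ 𝒜.biUnion id) + d ≤ n) {U : Finset (Fin n)}
    (hU : Disjoint U (D ∪ 𝒜.biUnion id)) (hUr : #U = r) :
    ∃ V, #V = d + ℓ - r ∧ ∃ 𝒜', #𝒜' = #𝒜 + 1 ∧ PetalFamily d ((U, V) :: h) R D 𝒜' := by
  -- The new petal is any `d`-set that contains `U` and still avoids everything so far; the reply
  -- adds `P \ U` and the common part `R`.
  obtain ⟨P, hUP, hPD, hPd⟩ := exists_subsuperset_card_eq
    (subset_compl_iff_disjoint_right.2 hU) (hUr.trans_le hrd)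
    (by rw [card_compl, Fintype.card_fin]; omega)
  have hPD' := subset_compl_iff_disjoint_right.1 hPD
  have hP1 : Disjoint P D := disjoint_of_subset_right subset_union_left hPD'
  have hP2 : ∀ P' ∈ 𝒜, Disjoint P P' := fun P' hP' =>
    disjoint_of_subset_right ((subset_biUnion_of_mem id hP').trans subset_union_right) hPD'
  -- A member of `𝒜` would be disjoint from itself, hence empty, contrary to `d ≥ 1`.
  have hP3 : P ∉ 𝒜 := fun hP => by
    have := hP2 P hP
    rw [disjoint_self_iff_empty] at this
    rw [this, card_empty] at hPd
    omega
  have hPR : Disjoint P R := disjoint_of_subset_right hR hP1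
  refine ⟨(P \ U) ∪ R, ?_, insert P 𝒜, card_insert_of_notMem hP3, ?_, ?_, ?_, ?_⟩
  · rw [card_union_of_disjoint (disjoint_of_subset_left sdiff_subset hPR),
      card_sdiff_of_subset hUP, hPd, hUr, hRℓ]
    omega
  · intro Q hQ
    rcases mem_insert.1 hQ with rfl | hQ
    · exact hPd
    · exact H.card_eq Q hQ
  · intro Q hQ
    rcases mem_insert.1 hQ with rfl | hQ
    · exact hP1
    · exact H.avoids Q hQ
  · intro Q hQ
    rcases mem_insert.1 hQ with rfl | hQ
    · refine ⟨_, List.mem_cons_self, ?_, ?_⟩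
      · exact disjoint_union_right.2 ⟨disjoint_sdiff, disjoint_of_subset_left hUP hPR⟩
      · simp only
        rw [← union_assoc, union_sdiff_of_subset hUP]
    · exact (H.isEdge Q hQ).cons _
  · intro Q hQ Q' hQ' hne
    rcases mem_insert.1 hQ with rfl | h1 <;> rcases mem_insert.1 hQ' with rfl | h2
    · exact absurd rfl hne
    · exact hP2 Q' h2
    · exact (hP2 Q h1).symm
    · exact H.pairwise Q h1 Q' h2 hne

/-- In a linear number of rounds one can build many petals. -/
theorem ReachesWithin.petals {γ : Type*} {n r d ℓ N k₀ : ℕ} (hr : 1 ≤ r) (hrd : r ≤ d)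
    (hn : d + ℓ ≤ n) (hn' : 4 * r * (k₀ + N * d + 1) ≤ n) (hn'' : k₀ + N * d + d ≤ n)
    (K : γ → History n → Prop)
    (hK : ∀ c h p, K c h → K c (p :: h)) (R D : γ → Finset (Fin n))
    (hR : ∀ c h, K c h → R c ⊆ D c) (hRℓ : ∀ c h, K c h → #(R c) = ℓ)
    (hD : ∀ c h, K c h → #(D c) ≤ k₀)
    {G : History n → Prop} {E : ℝ} (hE : 0 ≤ E)
    (h : ReachesWithin r (d + ℓ) G
      (fun h => ∃ c, K c h ∧ ∃ 𝒜, #𝒜 = N ∧ PetalFamily d h (R c) (D c) 𝒜) E) :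
    ReachesWithin r (d + ℓ) G (fun h => ∃ c, K c h) (E + 2 * N) := by
  classical
  -- The parameter `c` records what was built before and stays fixed while the petals are added.
  have key := ReachesWithin.iterate (by omega) hn hE
    (fun k h => ∃ c, K c h ∧ ∃ 𝒜, #𝒜 = k ∧ PetalFamily d h (R c) (D c) 𝒜) N ?_ ?_ h
  · exact key.mono (fun h ⟨c, hc⟩ => ⟨c, hc, ∅, rfl, by constructor <;> simp⟩) le_rfl
  · rintro k - h p ⟨c, hc, 𝒜, h𝒜, H⟩
    exact ⟨c, hK c h p hc, 𝒜, h𝒜, H.cons p⟩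
  rintro k hk h ⟨c, hc, 𝒜, h𝒜, H⟩
  have hcard : #(D c ∪ 𝒜.biUnion id) ≤ k₀ + N * d := by
    refine (card_union_le _ _).trans ?_
    rw [H.card_biUnion, h𝒜]
    have := hD c h hc
    gcongr
  refine ⟨_, filter_subset _ _, choose_le_two_mul_card_filter_disjoint hr (D c ∪ 𝒜.biUnion id)
    (le_trans (by gcongr) hn'), fun U hU => ?_⟩
  rw [mem_filter] at hU
  obtain ⟨V, hV, 𝒜', h𝒜', H'⟩ := H.exists_insert (by omega) hrd (hR c h hc) (hRℓ c h hc)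
    (by omega) hU.2 (mem_powersetCard.1 hU.1).2
  exact ⟨V, hV, c, hK c h _ hc, 𝒜', by rw [h𝒜', h𝒜], H'⟩

/-! ### From expected times to exponents -/

theorem exponentAt_le_of_reachesWithin {r s : ℕ} (hrs : r ≤ s)
    {P : ∀ n, MultiHypergraph n → Prop} {K a : ℝ} (hK : 0 < K) (ha : 0 ≤ a)
    (h : ∀ᶠ n : ℕ in atTop, ∃ Q : History n → Prop, Q [] ∧
      ReachesWithin r s (fun h => P n h.hypergraph) Q (K * (n : ℝ) ^ a))
    {q : ℝ} (hq : q < 1) : exponentAt r s P q ≤ (a : EReal) := by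
  have hq' : 0 < 1 - q := sub_pos.2 hq
  -- About `K * n ^ a / (1 - q)` rounds suffice; the extra 1 absorbs rounding up, since `n ^ a ≥ 1`.
  refine exponentAt_le (c := K / (1 - q) + 1) (by positivity) ?_
  filter_upwards [h, eventually_ge_atTop s, eventually_ge_atTop 1] with n ⟨Q, hQ, hE⟩ hs h1
  have h1' : (1 : ℝ) ≤ n := by exact_mod_cast h1
  set y := K * (n : ℝ) ^ a / (1 - q)
  have hy : 0 < y := by positivity
  have hopt := optTime_le_of_reachesWithin hrs hs hE hQ (q := q) (T := ⌈y⌉₊)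
    (Nat.ceil_pos.2 hy) (by
      have := Nat.le_ceil y
      rw [mul_comm (1 - q), ← div_le_iff₀ hq']
      exact this)
  refine (ENat.toENNReal_le.2 hopt).trans ?_
  have : (⌈y⌉₊ : ℝ) ≤ (K / (1 - q) + 1) * (n : ℝ) ^ a := by
    have h2 := (Nat.ceil_lt_add_one hy.le).le
    have h3 : 1 ≤ (n : ℝ) ^ a := Real.one_le_rpow h1' ha
    have h4 : y = K / (1 - q) * (n : ℝ) ^ a := by simp only [y]; ring
    rw [add_mul, ← h4]
    linarith
  calc _ = ENNReal.ofReal (⌈y⌉₊ : ℝ) := by simp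
    _ ≤ _ := ENNReal.ofReal_le_ofReal this

/-! ### Embedding the loose cycle -/

theorem containsCopy_looseCycle_cons {s ℓ m n : ℕ} [NeZero m] (h0 : 1 ≤ ℓ) (hs : 2 * ℓ ≤ s)
    (h : History n) (p : Finset (Fin n) × Finset (Fin n))
    (hc : ContainsCopy (looseCycle s ℓ m) n h.hypergraph) :
    ContainsCopy (looseCycle s ℓ m) n (History.hypergraph (p :: h)) := by
  rw [containsCopy_looseCycle_iff h0 hs] at hc ⊢
  obtain ⟨φ, hφ, hE⟩ := hc
  exact ⟨φ, hφ, fun j => (hE j).cons p⟩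

theorem exists_embeds_zero {α : Type*} [Fintype α] {n : ℕ} (hn : Fintype.card α ≤ n)
    (e : ℕ → Finset α) : ∃ φ : α → Fin n, Embeds e 0 φ [] := by
  obtain ⟨φ⟩ := Function.Embedding.nonempty_of_card_le (α := α) (β := Fin n) (by simpa using hn)
  exact ⟨φ, φ.injective, fun i hi => absurd hi (Nat.not_lt_zero i)⟩

theorem natCast_zmod_ne {m i k : ℕ} (hi : i < m) (hk : k < m) (h : i ≠ k) :
    (i : ZMod m) ≠ (k : ZMod m) := by
  rw [Ne, ZMod.natCast_eq_natCast_iff', Nat.mod_eq_of_lt hi, Nat.mod_eq_of_lt hk]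
  exact h

/-- If `r ≤ s - 2 * ℓ`, then a bounded number of rounds suffices. -/
theorem exponentAt_looseCycle_le_zero {s ℓ m r : ℕ} (h0 : 1 ≤ ℓ) (hs : 2 * ℓ ≤ s) (hm : 3 ≤ m)
    (hr : 1 ≤ r) (hrs : r ≤ s - 2 * ℓ) {q : ℝ} (hq : q < 1) :
    exponentAt r s (ContainsCopy (looseCycle s ℓ m)) q ≤ 0 := by
  have : NeZero m := ⟨by omega⟩
  have hmpos : (0 : ℝ) < m := by exact_mod_cast (by omega : 0 < m)
  refine exponentAt_le_of_reachesWithin (K := 2 * m) (a := 0) (by omega) (by positivity) le_rfl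
    ?_ hq
  filter_upwards [eventually_ge_atTop s,
    eventually_ge_atTop (4 * r * (Fintype.card (ZMod m × Fin (s - ℓ)) + 1))] with n hn1 hn2
  -- The random set will play inner vertices of its edge. There are `s - 2ℓ ≥ r` of them, all on no
  -- other edge, so the last edge is no harder than the first.
  have hS : ∀ j : ZMod m, ∃ S ⊆ (inner ℓ j : Finset (ZMod m × Fin (s - ℓ))), #S = r :=
    fun j => exists_subset_card_eq (by rw [card_inner (by omega)]; omega)
  choose S hS1 hS2 using hS
  refine ⟨fun h => ∃ φ : ZMod m × Fin (s - ℓ) → Fin n,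
    Embeds (fun i => cycEdge ℓ (i : ZMod m)) 0 φ h, exists_embeds_zero (by nlinarith) _, ?_⟩
  have hG := ReachesWithin.refl (r := r) (by omega) hn1
    (fun h p => containsCopy_looseCycle_cons (m := m) (n := n) h0 hs h p)
  refine (ReachesWithin.embeds (M := m) hr (by omega) hn1 hn2 _ (fun i => S i) ?_ ?_ ?_ ?_ le_rfl
    (hG.mono (fun h hh => ?_) le_rfl)).mono (fun _ => id) (by simp)
  · intro k _
    rw [card_cycEdge (by omega) (by omega)]
    omega
  · exact fun k _ => (hS1 k).trans (subset_union_right.trans subset_union_left)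
  · exact fun k _ => hS2 k
  · intro k hk i hik
    refine disjoint_of_subset_right (hS1 k) ?_
    rw [cycEdge, disjoint_union_left, disjoint_union_left]
    exact ⟨⟨disjoint_link_inner _ _ _,
      disjoint_inner_inner (natCast_zmod_ne (by omega) hk (by omega))⟩, disjoint_link_inner _ _ _⟩
  · obtain ⟨φ, hφ, hE⟩ := hh
    rw [containsCopy_looseCycle_iff h0 hs]
    refine ⟨φ, hφ, fun j => ?_⟩
    have : IsEdge h ((cycEdge ℓ (j.val : ZMod m)).image φ) := hE j.val (ZMod.val_lt j)
    rwa [ZMod.natCast_zmod_val] at this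

/-- The edges of the loose cycle other than `-1`, `0` and `1`. -/
def coreEdge (m d ℓ : ℕ) [NeZero m] (i : ℕ) : Finset (ZMod m × Fin d) :=
  cycEdge ℓ ((i + 2 : ℕ) : ZMod m)

/-- A random set that consists of a vertex of a petal at one end of the path, a vertex of a petal
at its other end, and fresh vertices, closes a cycle. -/
theorem exists_closing {m d ℓ n : ℕ} [NeZero m] (hm : 3 ≤ m) (h0 : 1 ≤ ℓ) (hℓ : ℓ ≤ d)
    {h : History n} {φ : ZMod m × Fin d → Fin n} (hφ : Embeds (coreEdge m d ℓ) (m - 3) φ h)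
    {P P' W : Finset (Fin n)} {a b : Fin n} (hP : #P = d) (hP' : #P' = d) (hW : #W = d - ℓ)
    (hPφ : ∀ v, φ v ∉ P) (hPφ' : ∀ v, φ v ∉ P') (hWφ : ∀ v, φ v ∉ W)
    (hPP' : Disjoint P P') (hPW : Disjoint P W) (hPW' : Disjoint P' W)
    (hPe : IsEdge h (P ∪ (link ℓ (1 + 1)).image φ))
    (hPe' : IsEdge h (P' ∪ (link ℓ (-1)).image φ)) (ha : a ∈ P) (hb : b ∈ P') :
    ∃ V, #V = 2 * ℓ - 2 ∧ ∃ φ' : ZMod m × Fin d → Fin n, Function.Injective φ' ∧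
      ∀ j : ZMod m, IsEdge ((insert a (insert b W), V) :: h) ((cycEdge ℓ j).image φ') := by
  have h10 : (1 : ZMod m) ≠ 0 := by simpa using add_one_ne_self (m := m) (by omega) 0
  have hneg0 : (-1 : ZMod m) ≠ 0 := neg_ne_zero.2 h10
  have hneg1 : (-1 : ZMod m) ≠ 1 := fun h => two_ne_zero_zmod hm (by
    nth_rewrite 1 [← h]; exact neg_add_cancel 1)
  have h21 : (1 + 1 : ZMod m) ≠ 1 := add_one_ne_self (by omega) 1
  -- `L` will be the link between the edges 0 and 1, and `L'` the link between the edges -1 and 0;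
  -- they contain the random vertices `a` and `b`.
  obtain ⟨L, haL, hLP, hL⟩ := exists_subsuperset_card_eq (n := ℓ) (singleton_subset_iff.2 ha)
    (by rwa [card_singleton]) (hℓ.trans_eq hP.symm)
  obtain ⟨L', hbL, hLP', hL'⟩ := exists_subsuperset_card_eq (n := ℓ) (singleton_subset_iff.2 hb)
    (by rwa [card_singleton]) (hℓ.trans_eq hP'.symm)
  rw [singleton_subset_iff] at haL hbL
  have hsP : P \ L ⊆ P := sdiff_subset
  have hsP' : P' \ L' ⊆ P' := sdiff_subset
  have hLL' : Disjoint L L' := disjoint_of_subset_left hLP (disjoint_of_subset_right hLP' hPP')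
  have hLW : Disjoint L W := disjoint_of_subset_left hLP hPW
  have hLW' : Disjoint L' W := disjoint_of_subset_left hLP' hPW'
  -- These are all vertices of the edges -1, 0 and 1, except for the links 2 and -1 to which the
  -- petals are attached. None of them is on a core edge, so they may be relabelled; `T` lists their
  -- new images.
  let S : Fin 5 → Finset (ZMod m × Fin d) :=
    ![link ℓ 1, inner ℓ 1, link ℓ 0, inner ℓ (-1), inner ℓ 0]
  let T : Fin 5 → Finset (Fin n) := ![L, P \ L, L', P' \ L', W]
  have hS : ∀ i j, i < j → Disjoint (S i) (S j) := by
    have e1 := disjoint_link_inner (m := m) (d := d) ℓ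
    have e2 : Disjoint (link ℓ 1 : Finset (ZMod m × Fin d)) (link ℓ 0) := disjoint_link_link h10
    have e3 : Disjoint (inner ℓ 1 : Finset (ZMod m × Fin d)) (inner ℓ (-1)) :=
      disjoint_inner_inner hneg1.symm
    have e4 : Disjoint (inner ℓ 1 : Finset (ZMod m × Fin d)) (inner ℓ 0) :=
      disjoint_inner_inner h10
    have e5 : Disjoint (inner ℓ (-1) : Finset (ZMod m × Fin d)) (inner ℓ 0) :=
      disjoint_inner_inner hneg0
    simp [S, Fin.forall_fin_succ, e1, e2, e3, e4, e5, (e1 _ _).symm]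
  have hT : ∀ i j, i < j → Disjoint (T i) (T j) := by
    have e1 : Disjoint L (P \ L) := disjoint_sdiff
    have e2 : Disjoint L (P' \ L') :=
      disjoint_of_subset_left hLP (disjoint_of_subset_right hsP' hPP')
    have e3 : Disjoint (P \ L) L' :=
      disjoint_of_subset_left hsP (disjoint_of_subset_right hLP' hPP')
    have e4 : Disjoint (P \ L) (P' \ L') :=
      disjoint_of_subset_left hsP (disjoint_of_subset_right hsP' hPP')
    have e5 : Disjoint (P \ L) W := disjoint_of_subset_left hsP hPW
    have e6 : Disjoint L' (P' \ L') := disjoint_sdiff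
    have e7 : Disjoint (P' \ L') W := disjoint_of_subset_left hsP' hPW'
    simp only [T, Fin.forall_fin_succ]
    simp [e1, e2, e3, e4, e5, e6, e7, hLL', hLW, hLW']
  have hST : ∀ i, #(S i) = #(T i) := by
    simp [S, T, Fin.forall_fin_succ, card_link hℓ, card_inner hℓ, hL, hL', hW,
      card_sdiff_of_subset hLP, card_sdiff_of_subset hLP', hP, hP']
  have hφT : ∀ i v, φ v ∉ T i := by
    have e1 : ∀ v, φ v ∉ L := fun v hv => hPφ v (hLP hv)
    have e2 : ∀ v, φ v ∉ L' := fun v hv => hPφ' v (hLP' hv)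
    have e3 : ∀ v, φ v ∉ P \ L := fun v hv => hPφ v (hsP hv)
    have e4 : ∀ v, φ v ∉ P' \ L' := fun v hv => hPφ' v (hsP' hv)
    intro i v
    fin_cases i
    exacts [e1 v, e3 v, e2 v, e4 v, hWφ v]
  have hsymm : ∀ {β : Type} [DecidableEq β] (X : Fin 5 → Finset β),
      (∀ i j, i < j → Disjoint (X i) (X j)) → ∀ i j, i ≠ j → Disjoint (X i) (X j) :=
    fun X hX i j hij => (lt_or_gt_of_ne hij).elim (hX i j) fun h => (hX j i h).symm
  obtain ⟨φ', hφ', hoff, him⟩ := exists_relabel hφ.1 S T (hsymm S hS) (hsymm T hT) hST hφT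
  have i0 : (link ℓ 1).image φ' = L := him 0
  have i1 : (inner ℓ 1).image φ' = P \ L := him 1
  have i2 : (link ℓ 0).image φ' = L' := him 2
  have i3 : (inner ℓ (-1)).image φ' = P' \ L' := him 3
  have i4 : (inner ℓ 0).image φ' = W := him 4
  have off_link : ∀ j : ZMod m, j ≠ 0 → j ≠ 1 →
      (link ℓ j).image φ' = (link ℓ j).image φ := by
    intro j hj0 hj1
    refine image_congr fun v hv => hoff v ?_
    have e1 := disjoint_left.1 (disjoint_link_link (d := d) (ℓ := ℓ) hj0) hv
    have e2 := disjoint_left.1 (disjoint_link_link (d := d) (ℓ := ℓ) hj1) hv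
    have e3 := fun k => disjoint_left.1 (disjoint_link_inner (d := d) ℓ j k) hv
    intro i
    fin_cases i
    exacts [e2, e3 _, e1, e3 _, e3 _]
  have off_inner : ∀ j : ZMod m, j ≠ 0 → j ≠ 1 → j ≠ -1 →
      (inner ℓ j).image φ' = (inner ℓ j).image φ := by
    intro j hj0 hj1 hj2
    refine image_congr fun v hv => hoff v ?_
    have e1 := disjoint_left.1 (disjoint_inner_inner (d := d) (ℓ := ℓ) hj0) hv
    have e2 := disjoint_left.1 (disjoint_inner_inner (d := d) (ℓ := ℓ) hj1) hv
    have e3 := disjoint_left.1 (disjoint_inner_inner (d := d) (ℓ := ℓ) hj2) hv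
    have e4 := fun k => disjoint_left.1 (disjoint_link_inner (d := d) ℓ k j).symm hv
    intro i
    fin_cases i
    exacts [e4 _, e2, e4 _, e3, e1]
  -- The player supplies the `ℓ - 1` missing vertices of each of the two links.
  refine ⟨L.erase a ∪ L'.erase b, ?_, φ', hφ', fun j => ?_⟩
  · rw [card_union_of_disjoint (disjoint_of_subset_left (erase_subset _ _)
      (disjoint_of_subset_right (erase_subset _ _) hLL')), card_erase_of_mem haL,
      card_erase_of_mem hbL, hL, hL']
    omega
  by_cases hj0 : j = 0
  · subst hj0
    refine ⟨_, List.mem_cons_self, ?_, ?_⟩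
    · rw [disjoint_left] at hLL' hLW hLW' ⊢
      intro v hv hv'
      simp only [mem_insert, mem_union, mem_erase] at hv hv'
      rcases hv with rfl | rfl | hv <;> rcases hv' with ⟨h1, h2⟩ | ⟨h1, h2⟩
      · exact h1 rfl
      · exact hLL' haL h2
      · exact hLL' h2 hbL
      · exact h1 rfl
      · exact hLW h2 hv
      · exact hLW' h2 hv
    · rw [cycEdge, image_union, image_union, zero_add, i0, i2, i4]
      ext v
      simp only [mem_insert, mem_union, mem_erase]
      by_cases h1 : v = a
      · subst h1; simp [haL]
      by_cases h2 : v = b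
      · subst h2; simp [hbL]
      tauto
  refine IsEdge.cons ?_ _
  by_cases hj1 : j = 1
  · subst hj1
    rwa [cycEdge, image_union, image_union, i0, i1,
      off_link _ (two_ne_zero_zmod hm) h21, union_sdiff_of_subset hLP]
  by_cases hj2 : j = -1
  · subst hj2
    rwa [cycEdge, image_union, image_union, neg_add_cancel, i2, i3, off_link _ hneg0 hneg1,
      union_assoc, union_comm, sdiff_union_of_subset hLP']
  -- For `j` other than -1, 0 and 1 the representative lies between 2 and `m - 2`, so `j` is the
  -- core edge with index `j.val - 2 < m - 3`.
  have hj : IsEdge h ((cycEdge ℓ j).image φ) := by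
    have hlt := ZMod.val_lt j
    have hv0 : j.val ≠ 0 := fun h => hj0 ((ZMod.val_eq_zero j).1 h)
    have hv1 : j.val ≠ 1 := fun h => hj1 (by
      rw [← ZMod.natCast_zmod_val j, h, Nat.cast_one])
    have hv2 : j.val ≠ m - 1 := fun h => hj2 (by
      rw [← ZMod.natCast_zmod_val j, h, Nat.cast_sub (by omega), ZMod.natCast_self, Nat.cast_one,
        zero_sub])
    have := hφ.2 (j.val - 2) (by omega)
    rwa [coreEdge, show j.val - 2 + 2 = j.val by omega, ZMod.natCast_zmod_val] at this
  rw [cycEdge, image_union, image_union] at hj ⊢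
  rw [off_link j hj0 hj1, off_inner j hj0 hj1 hj2, off_link (j + 1)]
  · exact hj
  · exact fun h => hj2 (eq_neg_of_add_eq_zero_left h)
  · exact fun h => hj0 (by simpa using h)

/-- The core of the loose cycle is built in a bounded number of rounds. -/
theorem ReachesWithin.core {m d ℓ n r : ℕ} [NeZero m] (hm : 3 ≤ m) (hℓ : ℓ ≤ d) (hr : 1 ≤ r)
    (hrd : r ≤ d) (hn : d + ℓ ≤ n) (hn' : 4 * r * (m * d + 1) ≤ n)
    {G : History n → Prop} {E : ℝ} (hE : 0 ≤ E)
    (h : ReachesWithin r (d + ℓ) G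
      (fun h => ∃ φ : ZMod m × Fin d → Fin n, Embeds (coreEdge m d ℓ) (m - 3) φ h) E) :
    ReachesWithin r (d + ℓ) G
      (fun h => ∃ φ : ZMod m × Fin d → Fin n, Embeds (coreEdge m d ℓ) 0 φ h)
      (E + 2 * (m - 3 : ℕ)) := by
  -- The core does not wrap around, so the far link of each new edge is fresh as well. This leaves
  -- `d` fresh vertices, and `r ≤ d` is enough.
  have hS : ∀ j : ZMod m,
      ∃ S ⊆ (inner ℓ j ∪ link ℓ (j + 1) : Finset (ZMod m × Fin d)), #S = r := fun j => by
    refine exists_subset_card_eq ?_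
    rw [card_union_of_disjoint (disjoint_link_inner _ _ _).symm, card_inner hℓ, card_link hℓ]
    omega
  choose S hS1 hS2 using hS
  have hsucc : ∀ k : ℕ, ((k + 2 : ℕ) : ZMod m) + 1 = ((k + 3 : ℕ) : ZMod m) := fun k => by
    push_cast; ring
  refine ReachesWithin.embeds hr (by omega) hn (by simpa [ZMod.card] using hn') _
    (fun k => S ((k + 2 : ℕ) : ZMod m)) ?_ ?_ ?_ ?_ hE h
  · exact fun k _ => card_cycEdge hℓ (by omega) _
  · intro k _
    refine (hS1 _).trans ?_
    rw [coreEdge, cycEdge, union_assoc]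
    exact subset_union_right
  · exact fun k _ => hS2 _
  · intro k hk i hik
    refine disjoint_of_subset_right (hS1 _) ?_
    rw [coreEdge, cycEdge, disjoint_union_right, disjoint_union_left, disjoint_union_left,
      disjoint_union_left, disjoint_union_left, hsucc, hsucc]
    exact ⟨⟨⟨disjoint_link_inner _ _ _,
      disjoint_inner_inner (natCast_zmod_ne (by omega) (by omega) (by omega))⟩,
      disjoint_link_inner _ _ _⟩,
      ⟨disjoint_link_link (natCast_zmod_ne (by omega) (by omega) (by omega)),
      (disjoint_link_inner _ _ _).symm⟩,
      disjoint_link_link (natCast_zmod_ne (by omega) (by omega) (by omega))⟩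

/-- Once the core and `N` petals at both of its ends are there, the cycle is closed within
`O(n ^ 2 / N ^ 2)` rounds. -/
theorem ReachesWithin.closing {m d ℓ n N : ℕ} [NeZero m] (hm : 3 ≤ m) (h0 : 2 ≤ ℓ) (hℓ : ℓ ≤ d)
    (hN : 1 ≤ N) (hn : 2 * (m * d + N * d + N * d + (d - ℓ + 2)) ≤ n) (hn' : d + ℓ ≤ n) :
    ReachesWithin (d - ℓ + 2) (d + ℓ)
      (fun h => ContainsCopy (looseCycle (d + ℓ) ℓ m) n h.hypergraph)
      (fun h => ∃ c : (ZMod m × Fin d → Fin n) × Finset (Finset (Fin n)),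
        (Embeds (coreEdge m d ℓ) (m - 3) c.1 h ∧ #c.2 = N ∧
          PetalFamily d h ((link ℓ (1 + 1)).image c.1) (univ.image c.1) c.2) ∧
        ∃ ℬ, #ℬ = N ∧
          PetalFamily d h ((link ℓ (-1)).image c.1) (univ.image c.1 ∪ c.2.biUnion id) ℬ)
      (2 ^ (d - ℓ + 2) * n ^ 2 / N ^ 2) := by
  classical
  have hNpos : (0 : ℝ) < N := by exact_mod_cast hN
  have hnpos : (0 : ℝ) < n := by exact_mod_cast (by omega : 0 < n)
  have hG : ReachesWithin (d - ℓ + 2) (d + ℓ)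
      (fun h => ContainsCopy (looseCycle (d + ℓ) ℓ m) n h.hypergraph) _ 0 :=
    ReachesWithin.refl (by omega) hn'
      (fun h p => containsCopy_looseCycle_cons (m := m) (n := n) (by omega) (by omega) h p)
  -- This `p` is the transversal count for the unions of the two petal families, each of size `N * d
  -- ≥ N`.
  refine (ReachesWithin.step (p := (N : ℝ) * N / (2 ^ (d - ℓ + 2) * n ^ 2)) (by omega) hn' le_rfl
    (by positivity) ?_ ?_ hG).mono (fun _ => id) (le_of_eq ?_)
  · rintro h p ⟨c, ⟨h1, h2, h3⟩, ℬ, h4, h5⟩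
    exact ⟨c, ⟨h1.cons p, h2, h3.cons p⟩, ℬ, h4, h5.cons p⟩
  · rintro h ⟨⟨φ, 𝒜⟩, ⟨hφ, h𝒜, HA⟩, ℬ, hℬ, HB⟩
    simp only at hφ h𝒜 HA HB
    have hcA : #(𝒜.biUnion id) = N * d := by rw [HA.card_biUnion, h𝒜]
    have hcB : #(ℬ.biUnion id) = N * d := by rw [HB.card_biUnion, hℬ]
    have hcD : #(univ.image φ) ≤ m * d := by
      exact card_image_le.trans_eq (by simp [ZMod.card])
    have hAB : Disjoint (𝒜.biUnion id) (ℬ.biUnion id) := by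
      rw [disjoint_biUnion_right]
      exact fun P hP => (disjoint_of_subset_right subset_union_right (HB.avoids P hP)).symm
    set F := univ.image φ ∪ 𝒜.biUnion id ∪ ℬ.biUnion id with hF
    have hcF : #F ≤ m * d + N * d + N * d := by
      refine (card_union_le _ _).trans ?_
      have := card_union_le (univ.image φ) (𝒜.biUnion id)
      omega
    have hNd : (N : ℝ) ≤ (N * d : ℕ) := by
      exact_mod_cast Nat.le_mul_of_pos_right N (by omega)
    let 𝒰 := {U ∈ powersetCard (d - ℓ + 2) (univ : Finset (Fin n)) |
      ∃ a ∈ 𝒜.biUnion id, ∃ b ∈ ℬ.biUnion id, ∃ W, #W = d - ℓ ∧ Disjoint W F ∧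
        U = insert a (insert b W)}
    refine ⟨𝒰, filter_subset _ _, ?_, ?_⟩
    · have := choose_mul_le_card_transversal (r := d - ℓ + 2) (by omega)
        (A := 𝒜.biUnion id) (B := ℬ.biUnion id) (D := F)
        (subset_union_right.trans subset_union_left) subset_union_right hAB (by omega) 𝒰 ?_
      · refine le_trans ?_ this
        rw [hcA, hcB]
        gcongr
      · intro a ha b hb W hW hWF
        have haF : a ∈ F := mem_union_left _ (mem_union_right _ ha)
        have hbF : b ∈ F := mem_union_right _ hb
        have hbW : b ∉ W := fun h => disjoint_left.1 hWF h hbF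
        have haW : a ∉ insert b W := by
          rw [mem_insert]
          rintro (rfl | h)
          · exact disjoint_left.1 hAB ha hb
          · exact disjoint_left.1 hWF h haF
        refine mem_filter.2 ⟨mem_powersetCard.2 ⟨subset_univ _, ?_⟩,
          a, ha, b, hb, W, hW, hWF, rfl⟩
        rw [card_insert_of_notMem haW, card_insert_of_notMem hbW, hW]
        omega
    · intro U hU
      obtain ⟨-, a, ha, b, hb, W, hW, hWF, rfl⟩ := mem_filter.1 hU
      obtain ⟨P, hP, haP⟩ := mem_biUnion.1 ha
      obtain ⟨P', hP', hbP⟩ := mem_biUnion.1 hb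
      have hφD : ∀ v, φ v ∈ univ.image φ := fun v => mem_image_of_mem _ (mem_univ v)
      have hPA : P ⊆ 𝒜.biUnion id := subset_biUnion_of_mem id hP
      have hPB : P' ⊆ ℬ.biUnion id := subset_biUnion_of_mem id hP'
      obtain ⟨V, hV, φ', hφ', hE⟩ := exists_closing hm (by omega) hℓ hφ (HA.card_eq P hP)
        (HB.card_eq P' hP') hW
        (fun v hv => disjoint_left.1 (HA.avoids P hP) hv (hφD v))
        (fun v hv => disjoint_left.1 (HB.avoids P' hP') hv (mem_union_left _ (hφD v)))
        (fun v hv => disjoint_left.1 hWF hv (mem_union_left _ (mem_union_left _ (hφD v))))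
        (disjoint_of_subset_left hPA (disjoint_of_subset_right hPB hAB))
        (disjoint_of_subset_left (hPA.trans (subset_union_right.trans subset_union_left))
          hWF.symm)
        (disjoint_of_subset_left (hPB.trans subset_union_right) hWF.symm)
        (HA.isEdge P hP) (HB.isEdge P' hP') haP hbP
      refine ⟨V, by omega, ?_⟩
      rw [containsCopy_looseCycle_iff (by omega) (by omega)]
      -- Transports the embedding from `Fin d` to `Fin (d + ℓ - ℓ)`.
      have hcongr : ∀ d', d' = d → ∃ φ : ZMod m × Fin d' → Fin n, Function.Injective φ ∧
          ∀ j : ZMod m, IsEdge ((insert a (insert b W), V) :: h) ((cycEdge ℓ j).image φ) := by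
        rintro d' rfl
        exact ⟨φ', hφ', hE⟩
      exact hcongr _ (by omega)
  · field_simp
    ring

/-- If `r = s - 2 * ℓ + 2`, then about `n ^ (2 / 3)` rounds suffice. -/
theorem exponentAt_looseCycle_le {d ℓ m : ℕ} (h0 : 2 ≤ ℓ) (hℓ : ℓ ≤ d) (hm : 3 ≤ m)
    {q : ℝ} (hq : q < 1) :
    exponentAt (d - ℓ + 2) (d + ℓ) (ContainsCopy (looseCycle (d + ℓ) ℓ m)) q ≤
      ((2 / 3 : ℝ) : EReal) := by
  have : NeZero m := ⟨by omega⟩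
  have hmpos : (0 : ℝ) < m := by exact_mod_cast (by omega : 0 < m)
  set r := d - ℓ + 2 with hrdef
  -- In units of `n ^ (2 / 3)`: `2 ^ r` for closing the cycle, `2 * N ≤ 4 * n ^ (2 / 3)` for each of
  -- the two petal families, and at most `2 * m` for the core.
  refine exponentAt_le_of_reachesWithin (K := 2 ^ r + 8 + 2 * m) (by omega) (by positivity)
    (by norm_num) ?_ hq
  -- Chosen so that `c * N ≤ n` implies all size conditions of the phases; it holds for large `n`
  -- because `N` has order `n ^ (2 / 3)`.
  set c : ℕ := 4 * r * (m * d + 2 * d + 1) + 2 * (d + ℓ) with hc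
  have hlarge : ∀ᶠ n : ℕ in atTop, (c * 2 : ℝ) ≤ (n : ℝ) ^ ((1 : ℝ) / 3) :=
    ((tendsto_rpow_atTop (by norm_num)).comp tendsto_natCast_atTop_atTop).eventually_ge_atTop _
  filter_upwards [hlarge, eventually_ge_atTop 1] with n hn h1
  have h1' : (1 : ℝ) ≤ n := by exact_mod_cast h1
  have hn0 : (0 : ℝ) < n := by linarith
  set y := (n : ℝ) ^ ((2 : ℝ) / 3) with hy
  have hy1 : 1 ≤ y := Real.one_le_rpow h1' (by norm_num)
  set N := ⌈y⌉₊ with hN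
  have hN1 : 1 ≤ N := Nat.one_le_iff_ne_zero.2 (Nat.ceil_pos.2 (by linarith)).ne'
  have hNy : y ≤ N := Nat.le_ceil y
  have hN2 : (N : ℝ) ≤ 2 * y := by
    have := Nat.ceil_lt_add_one (by linarith : 0 ≤ y)
    linarith
  have hcn : c * N ≤ n := by
    have : (n : ℝ) ^ ((1 : ℝ) / 3) * y = n := by
      rw [hy, ← Real.rpow_add hn0]; norm_num
    have : (c * N : ℝ) ≤ n := by
      calc (c * N : ℝ) ≤ c * (2 * y) := by gcongr
        _ = (c * 2) * y := by ring
        _ ≤ (n : ℝ) ^ ((1 : ℝ) / 3) * y := by gcongr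
        _ = n := this
    exact_mod_cast this
  have hmain : 4 * r * (m * d + N * d + N * d + 1) + 2 * (d + ℓ) ≤ n := by
    refine le_trans ?_ hcn
    have e : c * N = 4 * r * (m * d * N + 2 * (N * d) + N) + 2 * (d + ℓ) * N := by rw [hc]; ring
    rw [e]
    have e1 : m * d ≤ m * d * N := Nat.le_mul_of_pos_right _ hN1
    have e2 : 2 * (d + ℓ) ≤ 2 * (d + ℓ) * N := Nat.le_mul_of_pos_right _ hN1
    refine Nat.add_le_add (Nat.mul_le_mul_left _ ?_) e2
    omega
  have hr2 : 2 ≤ r := by omega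
  have hrd : r ≤ d := by omega
  have hlin : m * d + N * d + N * d + 1 ≤ r * (m * d + N * d + N * d + 1) :=
    Nat.le_mul_of_pos_left _ (by omega)
  have hmono : ∀ k ≤ m * d + N * d + N * d + 1, 4 * r * k ≤ n := fun k hk =>
    le_trans (Nat.mul_le_mul_left _ hk) (by omega)
  let D : (ZMod m × Fin d → Fin n) → Finset (Fin n) := fun φ => univ.image φ
  have hD : ∀ φ, #(D φ) ≤ m * d := fun φ => card_image_le.trans_eq (by simp [ZMod.card])
  -- The phases are composed backwards from the goal: closing, petals at the link -1, petals at the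
  -- link 2, core.
  have hstep1 := ReachesWithin.closing (N := N) hm h0 hℓ hN1 (by nlinarith) (by omega : d + ℓ ≤ n)
  have hE1 : (2 ^ (d - ℓ + 2) * n ^ 2 / N ^ 2 : ℝ) ≤ 2 ^ r * y := by
    rw [div_le_iff₀ (by positivity), mul_assoc]
    have : (n : ℝ) ^ 2 = y * y ^ 2 := by
      rw [hy, ← Real.rpow_natCast, ← Real.rpow_natCast, ← Real.rpow_mul hn0.le,
        ← Real.rpow_add hn0]
      norm_num
    rw [this]
    gcongr
  have hstep2 := ReachesWithin.petals (k₀ := m * d + N * d) (by omega) hrd (by omega : d + ℓ ≤ n)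
    (hmono _ le_rfl) (by nlinarith)
    (fun (c : (ZMod m × Fin d → Fin n) × Finset (Finset (Fin n))) h =>
      Embeds (coreEdge m d ℓ) (m - 3) c.1 h ∧ #c.2 = N ∧
        PetalFamily d h ((link ℓ (1 + 1)).image c.1) (D c.1) c.2)
    (fun c h p hh => ⟨hh.1.cons p, hh.2.1, hh.2.2.cons p⟩)
    (fun c => (link ℓ (-1)).image c.1) (fun c => D c.1 ∪ c.2.biUnion id)
    (fun c h _ => (image_subset_image (subset_univ _)).trans subset_union_left)
    (fun c h hh => by rw [card_image_of_injective _ hh.1.1, card_link hℓ])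
    (fun c h hh => by
      refine (card_union_le _ _).trans ?_
      rw [hh.2.2.card_biUnion, hh.2.1]
      exact Nat.add_le_add_right (hD _) _)
    (by positivity) hstep1
  have hstep3 := ReachesWithin.petals (k₀ := m * d) (by omega) hrd (by omega : d + ℓ ≤ n)
    (hmono _ (by omega)) (by nlinarith)
    (fun (φ : ZMod m × Fin d → Fin n) h => Embeds (coreEdge m d ℓ) (m - 3) φ h)
    (fun φ h p hh => hh.cons p)
    (fun φ => (link ℓ (1 + 1)).image φ) D
    (fun φ h _ => image_subset_image (subset_univ _))
    (fun φ h hh => by rw [card_image_of_injective _ hh.1, card_link hℓ])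
    (fun φ h _ => hD φ) (by positivity)
    (hstep2.mono (fun h ⟨φ, hφ, 𝒜, h𝒜, H⟩ => ⟨(φ, 𝒜), hφ, h𝒜, H⟩) le_rfl)
  have hstep4 := ReachesWithin.core hm hℓ (by omega) hrd (by omega : d + ℓ ≤ n)
    (hmono _ (by omega)) (by positivity) hstep3
  refine ⟨fun h => ∃ φ : ZMod m × Fin d → Fin n, Embeds (coreEdge m d ℓ) 0 φ h,
    exists_embeds_zero ?_ _, hstep4.mono (fun _ => id) ?_⟩
  · simp only [Fintype.card_prod, ZMod.card, Fintype.card_fin]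
    nlinarith
  · have hm3 : ((m - 3 : ℕ) : ℝ) ≤ m := by exact_mod_cast Nat.sub_le m 3
    have hmy : (m : ℝ) ≤ m * y := le_mul_of_one_le_right hmpos.le hy1
    nlinarith

/-! ### The lower bounds -/

theorem le_exponentAt_looseCycle {s ℓ m r x : ℕ} (h0 : 1 ≤ ℓ) (hs : 2 * ℓ ≤ s) (hm : 3 ≤ m)
    (hr : 1 ≤ r) (hrs : r ≤ s) (hx : x + (s - 2 * ℓ) ≤ r) {q : ℝ} (hq : 0 < q) :
    (((x : ℝ) / 3 : ℝ) : EReal) ≤ exponentAt r s (ContainsCopy (looseCycle s ℓ m)) q := by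
  have : NeZero m := ⟨by omega⟩
  obtain ⟨c, hc, h⟩ := le_optTime_of_hasHit (x := x) hr hrs (ContainsCopy (looseCycle s ℓ m))
    (fun n h hv hc => by
      obtain ⟨φ, hφ, hE⟩ := (containsCopy_looseCycle_iff h0 hs h).1 hc
      exact hasHit_of_isEdge h0 (by omega) hm (by omega) hφ h hv hE) hq
  exact le_exponentAt hc h

theorem not_containsCopy_looseCycle_zero {s ℓ m : ℕ} (h0 : 1 ≤ ℓ) (hs : 2 * ℓ ≤ s) (hm : 3 ≤ m)
    (n : ℕ) : ¬ ContainsCopy (looseCycle s ℓ m) n 0 := by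
  have : NeZero m := ⟨by omega⟩
  intro h
  obtain ⟨φ, -, hE⟩ := (containsCopy_looseCycle_iff h0 hs ([] : History n)).1 h
  obtain ⟨p, hp, -⟩ := hE 0
  simp at hp

theorem generalLowerBound_looseCycle {s ℓ m r : ℕ} (h0 : 1 ≤ ℓ) (hs : 2 * ℓ ≤ s) (hm : 3 ≤ m) :
    generalLowerBound r s (looseCycle s ℓ m) = r - (((s : ℝ) - ℓ) * m - s + r) / m := by
  have : NeZero m := ⟨by omega⟩
  have hv : (looseCycle s ℓ m).vertexSet.ncard = (s - ℓ) * m := by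
    rw [show (looseCycle s ℓ m).vertexSet = Set.univ from rfl, Set.ncard_univ, Nat.card_zmod]
  rw [generalLowerBound, hv, ncard_edgeSet_looseCycle h0 hs hm, Nat.cast_mul,
    Nat.cast_sub (by omega)]

/-- With `k = (s - ℓ) m` the general bound is `r - (s - ℓ) + (s - r) / m`. It is strictly decreasing
in `m` as `r < s`, and at `m = 3` it falls short of the other bound by `(s - ℓ - r) / 3 ≥ 0`. -/
theorem generalLowerBound_looseCycle_le {s ℓ m r : ℕ} (h0 : 1 ≤ ℓ) (hs : 2 * ℓ ≤ s) (hm : 3 ≤ m)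
    (hrs : r ≤ s - ℓ) :
    generalLowerBound r s (looseCycle s ℓ m) ≤ ((r : ℝ) - s + 2 * ℓ) / 3 ∧
      (4 ≤ m → generalLowerBound r s (looseCycle s ℓ m) < ((r : ℝ) - s + 2 * ℓ) / 3) := by
  have hm' : (3 : ℝ) ≤ m := by exact_mod_cast hm
  have hrs' : (r : ℝ) + ℓ ≤ s := by exact_mod_cast (by omega : r + ℓ ≤ s)
  have h0' : (1 : ℝ) ≤ ℓ := by exact_mod_cast h0
  rw [generalLowerBound_looseCycle h0 hs hm]
  have e : (r : ℝ) - (((s : ℝ) - ℓ) * m - s + r) / m = r - (s - ℓ) + (s - r) / m := by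
    field_simp
    ring
  rw [e]
  constructor
  · have : ((s : ℝ) - r) / m ≤ (s - r) / 3 :=
      div_le_div_of_nonneg_left (by linarith) (by norm_num) hm'
    linarith
  · intro h4
    have hm4 : (3 : ℝ) < m := by exact_mod_cast (by omega : 3 < m)
    have : ((s : ℝ) - r) / m < (s - r) / 3 :=
      div_lt_div_of_pos_left (by linarith) (by norm_num) hm4
    linarith

end SemiRandom

end

theorem mainTheorem11 (s ℓ m r : ℕ) (hℓ : 2 ≤ ℓ) (hs : 2 * ℓ ≤ s) (hm : 3 ≤ m)
    (hr : 1 ≤ r) (hrs : r ≤ s - ℓ) :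
    (r ≤ s - 2 * ℓ →
      SemiRandom.tau r s (SemiRandom.ContainsCopy (SemiRandom.looseCycle s ℓ m)) = 0) ∧
    (s - 2 * ℓ + 1 ≤ r →
      ((((r : ℝ) - s + 2 * ℓ) / 3 : ℝ) : EReal) ≤
        SemiRandom.tau r s (SemiRandom.ContainsCopy (SemiRandom.looseCycle s ℓ m))) ∧
    (r = s - 2 * ℓ + 2 →
      SemiRandom.tau r s (SemiRandom.ContainsCopy (SemiRandom.looseCycle s ℓ m)) =
          ((2 / 3 : ℝ) : EReal) ∧
        (4 ≤ m → SemiRandom.generalLowerBound r s (SemiRandom.looseCycle s ℓ m) < 2 / 3)) ∧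
    (s - 2 * ℓ + 1 ≤ r →
      SemiRandom.generalLowerBound r s (SemiRandom.looseCycle s ℓ m) ≤
          ((r : ℝ) - s + 2 * ℓ) / 3 ∧
        (4 ≤ m → SemiRandom.generalLowerBound r s (SemiRandom.looseCycle s ℓ m) <
          ((r : ℝ) - s + 2 * ℓ) / 3)) := by
  have hlower : s - 2 * ℓ + 1 ≤ r → ((((r : ℝ) - s + 2 * ℓ) / 3 : ℝ) : EReal) ≤
      SemiRandom.tau r s (SemiRandom.ContainsCopy (SemiRandom.looseCycle s ℓ m)) := by
    intro h
    refine SemiRandom.le_tau fun q hq _ => ?_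
    have hx := SemiRandom.le_exponentAt_looseCycle (x := r - (s - 2 * ℓ)) (r := r)
      (by omega : 1 ≤ ℓ) hs hm hr (by omega) (by omega) hq
    have e : ((r - (s - 2 * ℓ) : ℕ) : ℝ) = (r : ℝ) - s + 2 * ℓ := by
      rw [Nat.cast_sub (by omega), Nat.cast_sub hs]
      push_cast
      ring
    rwa [e] at hx
  have hbound := SemiRandom.generalLowerBound_looseCycle_le (by omega : 1 ≤ ℓ) hs hm hrs
  refine ⟨fun h => le_antisymm ?_ ?_, hlower, fun h => ?_, fun _ => hbound⟩
  · exact SemiRandom.tau_le fun q _ hq =>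
      SemiRandom.exponentAt_looseCycle_le_zero (by omega) hs hm hr h hq
  · exact SemiRandom.le_tau fun q hq _ => SemiRandom.zero_le_exponentAt
      (SemiRandom.not_containsCopy_looseCycle_zero (by omega) hs hm) hq
  · have e : (r : ℝ) - s + 2 * ℓ = 2 := by
      rw [h, Nat.cast_add, Nat.cast_sub hs]
      push_cast
      ring
    rw [e] at hlower hbound
    refine ⟨le_antisymm ?_ (hlower (by omega)), hbound.2⟩
    refine SemiRandom.tau_le fun q _ hq => ?_
    obtain ⟨d, rfl⟩ : ∃ d, s = d + ℓ := ⟨s - ℓ, by omega⟩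
    obtain rfl : r = d - ℓ + 2 := by omega
    exact SemiRandom.exponentAt_looseCycle_le hℓ (by omega) hm hq
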